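/- Let $d\in\mathbb N$, let $K$ be a real symmetric positive-definite $d\times d$ matrix, and let $A>0$ and $B$ be real constants. There is a constant $C=C(d,K,A,B)$, depending only on $d$, $K$, $A$ and $B$, with the following property. For every $n\in\mathbb N$ let $\mathbf S_n=(S_n^{(1)},\dots,S_n^{(d)})$ be a random vector in $\mathbb R^d$ (the $\mathbf S_n$ may be defined on different probability spaces) whose Laplace transform $\mathbb E[\mathrm e^{\langle \mathbf z,\mathbf S_n\rangle}]$ is finite for all $\mathbf z$ in some neighbourhood of $\mathbf 0$ in $\mathbb R^d$ (which may depend on $n$), and let $N_n>0$, $D_n>0$ be real numbers with $\lim_{n\to\infty} D_n/N_n=0$. For random variables $Y_1,\dots,Y_r$ denote by $$\kappa(Y_1,\dots,Y_r)=\left.\frac{\partial^r}{\partial z_1\cdots\partial z_r}\right|_{z_1=\cdots=z_r=0}\log \mathbb E\big[\mathrm e^{z_1Y_1+\cdots+z_rY_r}\big]$$ their joint cumulant. Suppose that 1. $\mathbb E[\mathbf S_n]=\mathbf 0$ for all $n$; 2. for all $n$ large enough and all $i,j\in\{1,\dots,d\}$, $\ \kappa(S_n^{(i)},S_n^{(j)})=N_nD_n\,K_{ij}\,(1+\delta_{n,i,j})$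 for some real $\delta_{n,i,j}$ with $|\delta_{n,i,j}|\le B\sqrt{D_n/N_n}$; 3. for all $n$, all $r\ge 3$ and all $i_1,\dots,i_r\in\{1,\dots,d\}$, $$\big|\kappa(S_n^{(i_1)},\dots,S_n^{(i_r)})\big|\le N_n\,(2D_n)^{r-1}A^r\,r^{r-2}.$$ Then, for all $n$ large enough, $$d_{\mathrm{convex}}\!\left(\frac{\mathbf S_n}{\sqrt{N_nD_n}},\ \mathcal N_{\mathbb R^d}(\mathbf 0,K)\right)\le C\,\sqrt{\frac{D_n}{N_n}},$$ where $\mathcal N_{\mathbb R^d}(\mathbf 0,K)$ is the centred Gaussian distribution on $\mathbb R^d$ with covariance matrix $K$, and $d_{\mathrm{convex}}(\mu,\nu)=\sup_{M}|\mu(M)-\nu(M)|$, the supremum being over all convex Borel sets $M\subseteq\mathbb R^d$ (a random vector standing for its law). -/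

import Mathlib

open MeasureTheory ProbabilityTheory Filter Topology

/-- The joint cumulant `κ(Y₁, …, Y_r)`: the mixed partial derivative
`∂^r / ∂z₁ ⋯ ∂z_r` at `z = 0` of `log E[exp (z₁ Y₁ + ⋯ + z_r Y_r)]`.
It is meaningful when this generating function is finite near `0`. -/
noncomputable def jointCumulant {Ω : Type*} [MeasurableSpace Ω] (P : Measure Ω) {r : ℕ}
    (Y : Fin r → Ω → ℝ) : ℝ :=
  iteratedFDeriv ℝ r
    (fun z : Fin r → ℝ => Real.log (∫ ω, Real.exp (∑ k, z k * Y k ω) ∂P)) 0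
    (fun k => Pi.single k 1)

/-- The convex distance between two probability measures: the supremum of `|μ(C) - ν(C)|`
over all convex Borel sets `C`. -/
noncomputable def convexDist {d : ℕ} (μ ν : Measure (EuclideanSpace ℝ (Fin d))) : ℝ :=
  ⨆ C : {C : Set (EuclideanSpace ℝ (Fin d)) // Convex ℝ C ∧ MeasurableSet C},
    |μ.real C.1 - ν.real C.1|

/-- The vector of signs encoded by a Boolean vector. -/
def signVec {d : ℕ} (σ : Fin d → Bool) : Fin d → ℝ := fun j => if σ j then 1 else -1

/-- The symmetric exponential weight `∑ exp ⟨σ, x⟩` over all sign vectors `σ`. -/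
noncomputable def expWeight {d : ℕ} (x : Fin d → ℝ) : ℝ :=
  ∑ σ : Fin d → Bool, Real.exp (∑ j, signVec σ j * x j)

lemma exp_sum_abs_le_expWeight {d : ℕ} (x : Fin d → ℝ) :
    Real.exp (∑ j, |x j|) ≤ expWeight x := by
  classical
  have h : (∑ j, |x j|) = ∑ j, signVec (fun j => decide (0 ≤ x j)) j * x j := by
    refine Finset.sum_congr rfl fun j _ => ?_
    by_cases hj : 0 ≤ x j
    · simp [signVec, hj, abs_of_nonneg hj]
    · simp [signVec, hj, abs_of_neg (not_le.1 hj)]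
  rw [h]
  exact Finset.single_le_sum
    (f := fun σ : Fin d → Bool => Real.exp (∑ j, signVec σ j * x j))
    (fun σ _ => (Real.exp_pos _).le) (Finset.mem_univ _)

lemma abs_signVec {d : ℕ} (σ : Fin d → Bool) (j : Fin d) : |signVec σ j| = 1 := by
  unfold signVec; split_ifs <;> simp

section Smooth

variable {Ω : Type*} [MeasurableSpace Ω] {P : Measure Ω} {d : ℕ} {X : Fin d → Ω → ℝ}

lemma integrable_exp_sum_abs (hX : ∀ j, AEMeasurable (X j) P) {ρ : ℝ}
    (h : ∀ x : Fin d → ℝ, (∀ j, |x j| ≤ |ρ|) →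
      Integrable (fun ω => Real.exp (∑ j, x j * X j ω)) P) :
    Integrable (fun ω => Real.exp (ρ * ∑ j, |X j ω|)) P := by
  have hint : Integrable (fun ω => expWeight (fun j => |ρ| * X j ω)) P := by
    unfold expWeight
    refine integrable_finsetSum _ fun σ _ => ?_
    have := h (fun j => signVec σ j * |ρ|) (fun j => by
      rw [abs_mul, abs_signVec, abs_abs, one_mul])
    simpa only [mul_assoc] using this
  refine hint.mono' ?_ (Eventually.of_forall fun ω => ?_)
  · have : AEMeasurable (fun ω => Real.exp (ρ * ∑ j, |X j ω|)) P :=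
      ((Finset.aemeasurable_fun_sum _ fun j _ => (hX j).abs).const_mul ρ).exp
    exact this.aestronglyMeasurable
  · rw [Real.norm_eq_abs, Real.abs_exp]
    refine le_trans (Real.exp_le_exp.2 ?_) (exp_sum_abs_le_expWeight _)
    simp only [abs_mul, abs_abs, ← Finset.mul_sum]
    exact mul_le_mul_of_nonneg_right (le_abs_self ρ) (Finset.sum_nonneg fun j _ => abs_nonneg _)

lemma abs_list_prod_le (l : List (Fin d)) (x : Fin d → ℝ) :
    |(l.map x).prod| ≤ (∑ j, |x j|) ^ l.length := by
  induction l with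
  | nil => simp
  | cons a l ih =>
    rw [List.map_cons, List.prod_cons, abs_mul, List.length_cons, pow_succ']
    exact mul_le_mul (Finset.single_le_sum (f := fun j => |x j|) (fun j _ => abs_nonneg _)
      (Finset.mem_univ a)) ih (abs_nonneg _) (Finset.sum_nonneg fun j _ => abs_nonneg _)

lemma abs_sum_mul_le_of_norm_le {x y : Fin d → ℝ} {c : ℝ} (hx : ‖x‖ ≤ c) :
    |∑ j, x j * y j| ≤ c * ∑ j, |y j| := by
  refine (Finset.abs_sum_le_sum_abs _ _).trans ?_
  rw [Finset.mul_sum]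
  refine Finset.sum_le_sum fun j _ => ?_
  rw [abs_mul]
  exact mul_le_mul_of_nonneg_right ((norm_le_pi_norm x j).trans hx) (abs_nonneg _)

lemma pow_mul_exp_le {ρ s : ℝ} (hρ : 0 < ρ) (hs : 0 ≤ s) (m : ℕ) :
    s ^ m * Real.exp (ρ / 2 * s) ≤ (m.factorial * (2 / ρ) ^ m) * Real.exp (ρ * s) := by
  have h1 := Real.pow_div_factorial_le_exp (x := ρ / 2 * s) (by positivity) m
  have h2 : s ^ m = (m.factorial * (2 / ρ) ^ m) * ((ρ / 2 * s) ^ m / m.factorial) := by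
    have h3 : s = 2 / ρ * (ρ / 2 * s) := by field_simp
    have h4 : (m.factorial : ℝ) ≠ 0 := by positivity
    conv_lhs => rw [h3, mul_pow]
    generalize (ρ / 2 * s) ^ m = a
    generalize (2 / ρ) ^ m = b
    field_simp
  have h3 : Real.exp (ρ * s) = Real.exp (ρ / 2 * s) * Real.exp (ρ / 2 * s) := by
    rw [← Real.exp_add]; ring_nf
  rw [h2, h3, mul_assoc, ]
  gcongr

lemma contDiffOn_integral_list_prod_mul_exp (hX : ∀ j, AEMeasurable (X j) P) {ρ : ℝ} (hρ : 0 < ρ)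
    (h : Integrable (fun ω => Real.exp (ρ * ∑ j, |X j ω|)) P) (n : ℕ) (l : List (Fin d)) :
    ContDiffOn ℝ n (fun x : Fin d → ℝ =>
      ∫ ω, (l.map (fun j => X j ω)).prod * Real.exp (∑ j, x j * X j ω) ∂P)
      (Metric.ball 0 (ρ / 2)) := by
  have hmeas : ∀ (l : List (Fin d)) (x : Fin d → ℝ), AEStronglyMeasurable
      (fun ω => (l.map (fun j => X j ω)).prod * Real.exp (∑ j, x j * X j ω)) P := by
    intro l x
    have h1 : AEMeasurable (fun ω => (l.map (fun j => X j ω)).prod) P := by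
      induction l with
      | nil => simp
      | cons a l ih => simpa only [List.map_cons, List.prod_cons] using (hX a).fun_mul ih
    exact (h1.mul (Finset.aemeasurable_fun_sum _ fun j _ =>
      (hX j).const_mul (x j)).exp).aestronglyMeasurable
  have hbound : ∀ (m : ℕ) (x : Fin d → ℝ), x ∈ Metric.ball (0 : Fin d → ℝ) (ρ / 2) → ∀ ω,
      (∑ j, |X j ω|) ^ m * Real.exp (∑ j, x j * X j ω)
        ≤ (m.factorial * (2 / ρ) ^ m) * Real.exp (ρ * ∑ j, |X j ω|) := by
    intro m x hx ω
    have hx' : ‖x‖ ≤ ρ / 2 := (mem_ball_zero_iff.1 hx).le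
    refine le_trans ?_ (pow_mul_exp_le hρ (Finset.sum_nonneg fun j _ => abs_nonneg _) m)
    refine mul_le_mul_of_nonneg_left (Real.exp_le_exp.2 ?_)
      (pow_nonneg (Finset.sum_nonneg fun j _ => abs_nonneg _) _)
    exact (le_abs_self _).trans (abs_sum_mul_le_of_norm_le hx')
  have hint : ∀ (l : List (Fin d)) (x : Fin d → ℝ), x ∈ Metric.ball (0 : Fin d → ℝ) (ρ / 2) →
      Integrable (fun ω => (l.map (fun j => X j ω)).prod * Real.exp (∑ j, x j * X j ω)) P := by
    intro l x hx
    refine (h.const_mul (l.length.factorial * (2 / ρ) ^ l.length)).mono' (hmeas l x)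
      (Eventually.of_forall fun ω => ?_)
    rw [Real.norm_eq_abs, abs_mul, Real.abs_exp]
    exact (mul_le_mul_of_nonneg_right (abs_list_prod_le l _) (Real.exp_pos _).le).trans
      (hbound _ x hx ω)
  have hderiv : ∀ (l : List (Fin d)) (x : Fin d → ℝ), x ∈ Metric.ball (0 : Fin d → ℝ) (ρ / 2) →
      HasFDerivAt (fun x : Fin d → ℝ =>
        ∫ ω, (l.map (fun j => X j ω)).prod * Real.exp (∑ j, x j * X j ω) ∂P)
        (∑ k, (∫ ω, ((k :: l).map (fun j => X j ω)).prod * Real.exp (∑ j, x j * X j ω) ∂P) •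
          (ContinuousLinearMap.proj k : (Fin d → ℝ) →L[ℝ] ℝ)) x := by
    intro l x hx
    have hnorm : ∀ k : Fin d, ‖(ContinuousLinearMap.proj k : (Fin d → ℝ) →L[ℝ] ℝ)‖ ≤ 1 :=
      fun k => ContinuousLinearMap.opNorm_le_bound _ zero_le_one fun y => by
        simpa using norm_le_pi_norm y k
    have key := hasFDerivAt_integral_of_dominated_of_fderiv_le (μ := P) (𝕜 := ℝ)
      (F := fun (x : Fin d → ℝ) ω => (l.map (fun j => X j ω)).prod * Real.exp (∑ j, x j * X j ω))
      (F' := fun (x : Fin d → ℝ) ω => ∑ k, (((k :: l).map (fun j => X j ω)).prod *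
        Real.exp (∑ j, x j * X j ω)) • (ContinuousLinearMap.proj k : (Fin d → ℝ) →L[ℝ] ℝ))
      (bound := fun ω => ((l.length + 1).factorial * (2 / ρ) ^ (l.length + 1)) *
        Real.exp (ρ * ∑ j, |X j ω|)) (x₀ := x) (Metric.isOpen_ball.mem_nhds hx)
      (Eventually.of_forall fun x => hmeas l x) (hint l x hx)
      (Finset.aestronglyMeasurable_fun_sum _ fun k _ => (hmeas (k :: l) x).smul_const _)
      (Eventually.of_forall fun ω y hy => ?_) (h.const_mul _)
      (Eventually.of_forall fun ω y hy => ?_)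
    · rwa [integral_finsetSum _ fun k _ => (hint (k :: l) x hx).smul_const _,
        Finset.sum_congr rfl fun k _ => integral_smul_const _ _] at key
    · refine le_trans ?_ (hbound (l.length + 1) y hy ω)
      refine (norm_sum_le _ _).trans ?_
      rw [pow_succ', mul_assoc, Finset.sum_mul]
      refine Finset.sum_le_sum fun k _ => ?_
      rw [norm_smul, List.map_cons, List.prod_cons, Real.norm_eq_abs, abs_mul, abs_mul,
        Real.abs_exp, mul_assoc, mul_assoc]
      refine mul_le_mul_of_nonneg_left ?_ (abs_nonneg _)
      refine mul_le_mul (abs_list_prod_le l _) ?_ (by positivity) (by positivity)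
      exact mul_le_of_le_one_right (Real.exp_pos _).le (hnorm k)
    · have h1 : HasFDerivAt (fun x : Fin d → ℝ => ∑ j, x j * X j ω)
          (∑ k, X k ω • (ContinuousLinearMap.proj k : (Fin d → ℝ) →L[ℝ] ℝ)) y := by
        refine HasFDerivAt.fun_sum fun k _ => ?_
        exact ((ContinuousLinearMap.proj k : (Fin d → ℝ) →L[ℝ] ℝ).hasFDerivAt).mul_const (X k ω)
      have h2 := (h1.exp).const_mul (l.map (fun j => X j ω)).prod
      convert! h2 using 1
      rw [Finset.smul_sum, Finset.smul_sum]
      refine Finset.sum_congr rfl fun k _ => ?_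
      rw [smul_smul, smul_smul, List.map_cons, List.prod_cons]
      congr 1; ring
  induction n generalizing l with
  | zero =>
    rw [Nat.cast_zero, contDiffOn_zero]
    exact fun x hx => (hderiv l x hx).continuousAt.continuousWithinAt
  | succ n ih =>
    rw [Nat.cast_succ, contDiffOn_succ_iff_hasFDerivWithinAt_of_uniqueDiffOn
      Metric.isOpen_ball.uniqueDiffOn]
    refine ⟨fun hn => by simp at hn, _, ?_, fun x hx => (hderiv l x hx).hasFDerivWithinAt⟩
    exact ContDiffOn.sum fun k _ => (ih (k :: l)).smul contDiffOn_const

lemma exists_integrable_exp_sum_abs (hX : ∀ j, AEMeasurable (X j) P)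
    (h : ∀ᶠ z in 𝓝 (0 : Fin d → ℝ), Integrable (fun ω => Real.exp (∑ j, z j * X j ω)) P) :
    ∃ ρ : ℝ, 0 < ρ ∧ Integrable (fun ω => Real.exp (ρ * ∑ j, |X j ω|)) P := by
  obtain ⟨ρ, hρ, hball⟩ := Metric.nhds_basis_closedBall.eventually_iff.1 h
  refine ⟨ρ, hρ, integrable_exp_sum_abs hX fun x hx => hball ?_⟩
  rw [abs_of_pos hρ] at hx
  rw [mem_closedBall_zero_iff, pi_norm_le_iff_of_nonneg hρ.le]
  exact hx

lemma integrable_exp_sum_of_norm_le (hX : ∀ j, AEMeasurable (X j) P) {ρ : ℝ}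
    (h : Integrable (fun ω => Real.exp (ρ * ∑ j, |X j ω|)) P) {x : Fin d → ℝ} (hx : ‖x‖ ≤ ρ) :
    Integrable (fun ω => Real.exp (∑ j, x j * X j ω)) P := by
  refine h.mono' (Finset.aemeasurable_fun_sum _ fun j _ =>
      (hX j).const_mul (x j)).exp.aestronglyMeasurable (Eventually.of_forall fun ω => ?_)
  rw [Real.norm_eq_abs, Real.abs_exp]
  exact Real.exp_le_exp.2 ((le_abs_self _).trans (abs_sum_mul_le_of_norm_le hx))

lemma contDiffOn_log_integral_exp [NeZero P] (hX : ∀ j, AEMeasurable (X j) P) {ρ : ℝ} (hρ : 0 < ρ)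
    (h : Integrable (fun ω => Real.exp (ρ * ∑ j, |X j ω|)) P) (n : ℕ) :
    ContDiffOn ℝ n (fun x : Fin d → ℝ => Real.log (∫ ω, Real.exp (∑ j, x j * X j ω) ∂P))
      (Metric.ball 0 (ρ / 2)) := by
  have h1 := contDiffOn_integral_list_prod_mul_exp hX hρ h n []
  simp only [List.map_nil, List.prod_nil, one_mul] at h1
  refine h1.log fun x hx => (integral_exp_pos (integrable_exp_sum_of_norm_le hX h ?_)).ne'
  have := mem_ball_zero_iff.1 hx
  linarith

lemma iteratedFDeriv_comp_clm_zero {E G : Type*} [NormedAddCommGroup E] [NormedSpace ℝ E]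
    [NormedAddCommGroup G] [NormedSpace ℝ G] {f : E → ℝ} {U : Set E} (hU : IsOpen U)
    (h0 : (0 : E) ∈ U) (L : G →L[ℝ] E) {r : ℕ} (hf : ContDiffOn ℝ r f U) (v : Fin r → G) :
    iteratedFDeriv ℝ r (fun z => f (L z)) 0 v = iteratedFDeriv ℝ r f 0 (fun k => L (v k)) := by
  have hV : IsOpen (L ⁻¹' U) := hU.preimage L.continuous
  have h0' : (0 : G) ∈ L ⁻¹' U := by simpa using h0
  have h := L.iteratedFDerivWithin_comp_right (x := 0) hf hU.uniqueDiffOn hV.uniqueDiffOn h0'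
    (i := r) le_rfl
  rw [iteratedFDerivWithin_of_isOpen r hV h0', iteratedFDerivWithin_of_isOpen r hU
    (by simpa using h0)] at h
  have h' := congrArg (fun M => M v) h
  rw [ContinuousMultilinearMap.compContinuousLinearMap_apply, map_zero] at h'
  exact h'

variable [IsProbabilityMeasure P]

lemma jointCumulant_eq_iteratedFDeriv (hX : ∀ j, AEMeasurable (X j) P)
    (h : ∀ᶠ z in 𝓝 (0 : Fin d → ℝ), Integrable (fun ω => Real.exp (∑ j, z j * X j ω)) P)
    {r : ℕ} (i : Fin r → Fin d) :
    jointCumulant P (fun k => X (i k)) =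
      iteratedFDeriv ℝ r (fun x : Fin d → ℝ => Real.log (∫ ω, Real.exp (∑ j, x j * X j ω) ∂P)) 0
        (fun k => Pi.single (i k) 1) := by
  obtain ⟨ρ, hρ, hint⟩ := exists_integrable_exp_sum_abs hX h
  let L : (Fin r → ℝ) →L[ℝ] (Fin d → ℝ) :=
    ∑ k, (ContinuousLinearMap.proj k : (Fin r → ℝ) →L[ℝ] ℝ).smulRight
      (Pi.single (i k) (1 : ℝ) : Fin d → ℝ)
  have hL : ∀ (z : Fin r → ℝ) (y : Fin d → ℝ), ∑ j, L z j * y j = ∑ k, z k * y (i k) := by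
    intro z y
    simp only [L, sum_apply, ContinuousLinearMap.smulRight_apply,
      ContinuousLinearMap.proj_apply, Finset.sum_apply, Pi.smul_apply, smul_eq_mul, Finset.sum_mul]
    rw [Finset.sum_comm]
    refine Finset.sum_congr rfl fun k _ => ?_
    simp [Pi.single_apply]
  have key := iteratedFDeriv_comp_clm_zero Metric.isOpen_ball
    (Metric.mem_ball_self (half_pos hρ)) L (contDiffOn_log_integral_exp hX hρ hint r)
    (fun k => Pi.single k 1)
  have hLs : ∀ k, L (Pi.single k 1) = Pi.single (i k) 1 := by
    intro k
    simp only [L, sum_apply, ContinuousLinearMap.smulRight_apply,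
      ContinuousLinearMap.proj_apply]
    rw [Finset.sum_eq_single k] <;> simp +contextual
  unfold jointCumulant
  simp only [hLs] at key
  rw [← key]
  have hfun : (fun z : Fin r → ℝ => Real.log (∫ ω, Real.exp (∑ k, z k * X (i k) ω) ∂P)) =
      fun z => Real.log (∫ ω, Real.exp (∑ j, L z j * X j ω) ∂P) :=
    funext fun z => by simp only [fun ω => hL z (fun j => X j ω)]
  rw [hfun]

lemma iteratedDeriv_cgf_eq_iteratedFDeriv (hX : ∀ j, AEMeasurable (X j) P)
    (h : ∀ᶠ z in 𝓝 (0 : Fin d → ℝ), Integrable (fun ω => Real.exp (∑ j, z j * X j ω)) P)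
    (r : ℕ) (θ : Fin d → ℝ) :
    iteratedDeriv r (cgf (fun ω => ∑ j, θ j * X j ω) P) 0 =
      iteratedFDeriv ℝ r (fun x : Fin d → ℝ => Real.log (∫ ω, Real.exp (∑ j, x j * X j ω) ∂P)) 0
        (fun _ => θ) := by
  obtain ⟨ρ, hρ, hint⟩ := exists_integrable_exp_sum_abs hX h
  have key := iteratedFDeriv_comp_clm_zero Metric.isOpen_ball
    (Metric.mem_ball_self (half_pos hρ)) ((ContinuousLinearMap.id ℝ ℝ).smulRight θ)
    (contDiffOn_log_integral_exp hX hρ hint r) (fun _ => 1)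
  rw [iteratedDeriv_eq_iteratedFDeriv]
  simp only [ContinuousLinearMap.smulRight_apply, ContinuousLinearMap.id_apply, one_smul] at key
  rw [← key]
  have hfun : cgf (fun ω => ∑ j, θ j * X j ω) P =
      fun t => Real.log (∫ ω, Real.exp (∑ j, (t • θ) j * X j ω) ∂P) :=
    funext fun t => by simp only [cgf, mgf, Pi.smul_apply, smul_eq_mul, Finset.mul_sum, mul_assoc]
  rw [hfun]

/-- The cumulants of a linear combination are polynomials in the coefficients, whose coefficients
are the joint cumulants. -/
theorem iteratedDeriv_cgf_linear_combination (hX : ∀ j, AEMeasurable (X j) P)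
    (h : ∀ᶠ z in 𝓝 (0 : Fin d → ℝ), Integrable (fun ω => Real.exp (∑ j, z j * X j ω)) P)
    (r : ℕ) (θ : Fin d → ℝ) :
    iteratedDeriv r (cgf (fun ω => ∑ j, θ j * X j ω) P) 0 =
      ∑ i : Fin r → Fin d, (∏ k, θ (i k)) * jointCumulant P (fun k => X (i k)) := by
  rw [iteratedDeriv_cgf_eq_iteratedFDeriv hX h]
  have hθ : θ = ∑ j, θ j • (Pi.single j (1 : ℝ) : Fin d → ℝ) := by
    ext k; simp [Finset.sum_apply, Pi.single_apply]
  conv_lhs => rw [hθ]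
  rw [ContinuousMultilinearMap.map_sum]
  refine Finset.sum_congr rfl fun i _ => ?_
  rw [ContinuousMultilinearMap.map_smul_univ, jointCumulant_eq_iteratedFDeriv hX h, smul_eq_mul]

end Smooth

lemma frequently_nhdsNE_ofReal {x : ℝ} {p : ℂ → Prop} (h : ∀ᶠ t : ℝ in 𝓝 x, p t) :
    ∃ᶠ z in 𝓝[≠] (x : ℂ), p z := by
  have h1 : Tendsto (fun t : ℝ => (t : ℂ)) (𝓝[≠] x) (𝓝[≠] (x : ℂ)) := by
    refine tendsto_nhdsWithin_iff.2 ⟨?_, ?_⟩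
    · exact (Complex.continuous_ofReal.tendsto x).mono_left nhdsWithin_le_nhds
    · filter_upwards [self_mem_nhdsWithin] with t ht
      simpa using ht
  exact h1.frequently (h.filter_mono nhdsWithin_le_nhds).frequently

section OneDim

variable {Ω : Type*} [MeasurableSpace Ω] {P : Measure Ω} {Y : Ω → ℝ} {H : ℂ → ℂ}

lemma eventually_complexMGF_eq (h0 : 0 ∈ interior (integrableExpSet Y P))
    (hH : AnalyticAt ℂ H 0) (hm : ∀ᶠ t : ℝ in 𝓝 0, (mgf Y P t : ℂ) = H t) :
    complexMGF Y P =ᶠ[𝓝 0] H := by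
  have ha : AnalyticAt ℂ (complexMGF Y P) 0 := analyticAt_complexMGF (by simpa using h0)
  refine (ha.frequently_eq_iff_eventually_eq hH).1 ?_
  have := frequently_nhdsNE_ofReal (x := 0) (p := fun z => complexMGF Y P z = H z)
    (hm.mono fun t ht => by rw [complexMGF_ofReal, ht])
  simpa using this

/-- If the moment generating function of `Y` extends holomorphically to a disc around `0`,
then it is finite on the real points of that disc. -/
theorem integrable_exp_mul_of_mgf_extends (hY : AEMeasurable Y P)
    (h0 : 0 ∈ interior (integrableExpSet Y P)) {R : ℝ}
    (hH : DifferentiableOn ℂ H (Metric.ball 0 R))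
    (hm : ∀ᶠ t : ℝ in 𝓝 0, (mgf Y P t : ℂ) = H t) {t : ℝ} (ht : |t| < R) :
    Integrable (fun ω => Real.exp (t * Y ω)) P := by
  have hR : 0 < R := (abs_nonneg t).trans_lt ht
  have heq := eventually_complexMGF_eq h0
    (hH.analyticAt (Metric.isOpen_ball.mem_nhds (Metric.mem_ball_self hR))) hm
  have hder : ∀ n, iteratedDeriv n H 0 = ((∫ ω, Y ω ^ n ∂P : ℝ) : ℂ) := by
    intro n
    rw [← (heq.iteratedDeriv_eq n), iteratedDeriv_complexMGF (by simpa using h0)]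
    simp only [zero_mul, Complex.exp_zero, mul_one]
    rw [← integral_complex_ofReal]
    simp
  have hsum := Complex.hasSum_taylorSeries_on_ball hH (z := (t : ℂ)) (by simpa using ht)
  have hsum2 : Summable (fun n : ℕ => ∫ ω, (t * Y ω) ^ (2 * n) / (2 * n).factorial ∂P) := by
    have h1 := (hsum.summable.norm).comp_injective (i := fun n : ℕ => 2 * n)
      (fun a b hab => by simpa using hab)
    refine h1.congr fun n => ?_
    simp only [Function.comp, hder, sub_zero, norm_smul, norm_inv, norm_pow, Complex.norm_natCast,
      Complex.norm_real, Real.norm_eq_abs]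
    rw [integral_div, div_eq_inv_mul]
    simp only [mul_pow]
    rw [integral_const_mul, abs_of_nonneg (a := ∫ ω, Y ω ^ (2 * n) ∂P)
      (integral_nonneg fun ω => Even.pow_nonneg (by simp) _), pow_mul |t|, sq_abs, ← pow_mul]
  have hnn : ∀ n ω, 0 ≤ (t * Y ω) ^ (2 * n) / (2 * n).factorial := fun n ω =>
    div_nonneg (Even.pow_nonneg (by simp) _) (by positivity)
  have hint : ∀ n, Integrable (fun ω => (t * Y ω) ^ (2 * n) / (2 * n).factorial) P := by
    intro n
    simp only [mul_pow]
    exact ((integrable_pow_of_mem_interior_integrableExpSet h0 _).const_mul _).div_const _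
  have hcosh : ∀ ω, HasSum (fun n : ℕ => (t * Y ω) ^ (2 * n) / (2 * n).factorial)
      (Real.cosh (t * Y ω)) := fun ω => Real.hasSum_cosh _
  have hlint : ∫⁻ ω, ENNReal.ofReal (Real.cosh (t * Y ω)) ∂P < ⊤ := by
    have : ∀ ω, ENNReal.ofReal (Real.cosh (t * Y ω)) =
        ∑' n : ℕ, ENNReal.ofReal ((t * Y ω) ^ (2 * n) / (2 * n).factorial) := fun ω => by
      rw [← (hcosh ω).tsum_eq]
      exact ENNReal.ofReal_tsum_of_nonneg (fun n => hnn n ω) (hcosh ω).summable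
    simp only [this]
    rw [lintegral_tsum fun n => (hint n).aemeasurable.ennreal_ofReal]
    simp only [← ofReal_integral_eq_lintegral_ofReal (hint _) (Eventually.of_forall (hnn _))]
    rw [← ENNReal.ofReal_tsum_of_nonneg (fun n => integral_nonneg (hnn n)) hsum2]
    exact ENNReal.ofReal_lt_top
  have hcoshint : Integrable (fun ω => Real.cosh (t * Y ω)) P := by
    refine ⟨(Real.measurable_cosh.comp_aemeasurable (hY.const_mul t)).aestronglyMeasurable, ?_⟩
    rw [hasFiniteIntegral_iff_ofReal (Eventually.of_forall fun ω => (Real.cosh_pos _).le)]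
    exact hlint
  refine (hcoshint.const_mul 2).mono' (hY.const_mul t).exp.aestronglyMeasurable
    (Eventually.of_forall fun ω => ?_)
  rw [Real.norm_eq_abs, Real.abs_exp, Real.cosh_eq]
  have := Real.exp_pos (-(t * Y ω))
  linarith

theorem mgf_eq_of_mgf_extends (hY : AEMeasurable Y P)
    (h0 : 0 ∈ interior (integrableExpSet Y P)) {R : ℝ}
    (hH : DifferentiableOn ℂ H (Metric.ball 0 R))
    (hm : ∀ᶠ t : ℝ in 𝓝 0, (mgf Y P t : ℂ) = H t) {t : ℝ} (ht : |t| < R) :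
    (mgf Y P t : ℂ) = H t := by
  have hR : 0 < R := (abs_nonneg t).trans_lt ht
  have hsub : Set.Ioo (-R) R ⊆ interior (integrableExpSet Y P) :=
    interior_maximal (fun s hs => integrable_exp_mul_of_mgf_extends hY h0 hH hm
      (abs_lt.2 hs)) isOpen_Ioo
  have hA : AnalyticOnNhd ℂ (complexMGF Y P) (Metric.ball 0 R) := fun z hz =>
    analyticAt_complexMGF (hsub (abs_lt.1 ((Complex.abs_re_le_norm z).trans_lt
      (mem_ball_zero_iff.1 hz))))
  have := hA.eqOn_of_preconnected_of_frequently_eq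
    (hH.analyticOnNhd Metric.isOpen_ball) (convex_ball (0 : ℂ) R).isPreconnected
    (Metric.mem_ball_self hR) (((eventually_complexMGF_eq h0
    (hH.analyticAt (Metric.isOpen_ball.mem_nhds (Metric.mem_ball_self hR))) hm).filter_mono
      nhdsWithin_le_nhds).frequently) (x := (t : ℂ)) (by simpa using ht)
  rwa [complexMGF_ofReal] at this

end OneDim

section MultiDim

variable {Ω : Type*} [MeasurableSpace Ω] {P : Measure Ω} {d : ℕ} {X : Fin d → Ω → ℝ}

lemma isOpen_sum_norm_lt (a ξ : Fin d → ℝ) (δ : ℝ) :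
    IsOpen {w : ℂ | ∑ j, ‖(a j : ℂ) + w * ξ j‖ < δ} :=
  isOpen_lt (by fun_prop) continuous_const

lemma convex_sum_norm_lt (a ξ : Fin d → ℝ) (δ : ℝ) :
    Convex ℝ {w : ℂ | ∑ j, ‖(a j : ℂ) + w * ξ j‖ < δ} := by
  intro w hw v hv s t hs ht hst
  have hw' : ∑ j, ‖(a j : ℂ) + w * ξ j‖ < δ := hw
  have hv' : ∑ j, ‖(a j : ℂ) + v * ξ j‖ < δ := hv
  have key : ∑ j, ‖(a j : ℂ) + (s • w + t • v) * ξ j‖ ≤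
      s * ∑ j, ‖(a j : ℂ) + w * ξ j‖ + t * ∑ j, ‖(a j : ℂ) + v * ξ j‖ := by
    rw [Finset.mul_sum, Finset.mul_sum, ← Finset.sum_add_distrib]
    refine Finset.sum_le_sum fun j _ => ?_
    have hst' : (s : ℂ) + t = 1 := by exact_mod_cast hst
    have : (a j : ℂ) + (s • w + t • v) * ξ j =
        s • ((a j : ℂ) + w * ξ j) + t • ((a j : ℂ) + v * ξ j) := by
      simp only [Complex.real_smul]
      linear_combination (-(a j : ℂ)) * hst'
    rw [this]
    refine (norm_add_le _ _).trans ?_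
    rw [norm_smul, norm_smul, Real.norm_of_nonneg hs, Real.norm_of_nonneg ht]
  refine key.trans_lt ?_
  rcases hs.eq_or_lt with rfl | hs
  · have : t = 1 := by linarith
    subst this; simpa using hv'
  · calc _ < s * δ + t * δ := by
          refine add_lt_add_of_lt_of_le (mul_lt_mul_of_pos_left hw' hs)
            (mul_le_mul_of_nonneg_left hv'.le ht)
      _ = δ := by rw [← add_mul, hst, one_mul]

/-- If the moment generating function of a random vector is given on a real cross-polytope by a
function which is holomorphic along complexified real lines, then the same formula holds on the
complex cross-polytope. -/
theorem integral_cexp_eq_of_real [NeZero P] {δ : ℝ} {H : (Fin d → ℂ) → ℂ}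
    (hH : ∀ a ξ : Fin d → ℝ, DifferentiableOn ℂ (fun w : ℂ => H (fun j => a j + w * ξ j))
      {w : ℂ | ∑ j, ‖(a j : ℂ) + w * ξ j‖ < δ})
    (hint : ∀ θ : Fin d → ℝ, ∑ j, |θ j| < δ →
      Integrable (fun ω => Real.exp (∑ j, θ j * X j ω)) P)
    (hreal : ∀ θ : Fin d → ℝ, ∑ j, |θ j| < δ →
      ((∫ ω, Real.exp (∑ j, θ j * X j ω) ∂P : ℝ) : ℂ) = H (fun j => θ j))
    {z : Fin d → ℂ} (hz : ∑ j, ‖z j‖ < δ) :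
    ∫ ω, Complex.exp (∑ j, z j * X j ω) ∂P = H z := by
  set a : Fin d → ℝ := fun j => (z j).re with ha
  set ξ : Fin d → ℝ := fun j => (z j).im with hξ
  have hzI : ∀ j, z j = a j + Complex.I * ξ j := fun j => by
    rw [mul_comm]; exact (Complex.re_add_im (z j)).symm
  have hI : Complex.I ∈ {w : ℂ | ∑ j, ‖(a j : ℂ) + w * ξ j‖ < δ} := by
    change ∑ j, ‖(a j : ℂ) + Complex.I * ξ j‖ < δ
    simpa only [← hzI] using hz
  have haδ : ∑ j, |a j| < δ :=
    (Finset.sum_le_sum fun j _ => Complex.abs_re_le_norm (z j)).trans_lt hz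
  have h0 : (0 : ℂ) ∈ {w : ℂ | ∑ j, ‖(a j : ℂ) + w * ξ j‖ < δ} := by
    change ∑ j, ‖(a j : ℂ) + 0 * ξ j‖ < δ
    simpa using haδ
  set f : Ω → ℝ := fun ω => ∑ j, a j * X j ω with hf
  set Y : Ω → ℝ := fun ω => ∑ j, ξ j * X j ω with hY
  set c : ℝ := ∫ ω, Real.exp (f ω) ∂P with hc
  have hcpos : 0 < c := integral_exp_pos (hint a haδ)
  have htilt : ∀ w : ℂ, (c : ℂ) * complexMGF Y (P.tilted f) w =
      ∫ ω, Complex.exp (∑ j, (a j + w * ξ j) * X j ω) ∂P := by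
    intro w
    rw [complexMGF, integral_tilted, ← integral_const_mul]
    refine integral_congr_ae (Eventually.of_forall fun ω => ?_)
    have hcc : (c : ℂ) ≠ 0 := by exact_mod_cast hcpos.ne'
    simp only [Complex.real_smul, ← hc]
    push_cast
    rw [← mul_assoc, mul_div_cancel₀ _ hcc, ← Complex.exp_add]
    congr 1
    simp only [hf, hY]
    push_cast
    rw [Finset.mul_sum, ← Finset.sum_add_distrib]
    exact Finset.sum_congr rfl fun j _ => by ring
  have hstrip : ∀ w ∈ {w : ℂ | ∑ j, ‖(a j : ℂ) + w * ξ j‖ < δ},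
      w.re ∈ interior (integrableExpSet Y (P.tilted f)) := by
    intro w hw
    have hopen : IsOpen {s : ℝ | ∑ j, |a j + s * ξ j| < δ} :=
      isOpen_lt (by fun_prop) continuous_const
    refine interior_maximal (fun s hs => ?_) hopen ?_
    · change Integrable _ _
      rw [integrable_tilted_iff (hint a haδ)]
      refine (hint (fun j => a j + s * ξ j) hs).congr (Eventually.of_forall fun ω => ?_)
      simp only [smul_eq_mul, ← Real.exp_add]
      congr 1
      simp only [hY]
      rw [Finset.mul_sum, ← Finset.sum_add_distrib]
      exact Finset.sum_congr rfl fun j _ => by ring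
    · have hw' : ∑ j, ‖(a j : ℂ) + w * ξ j‖ < δ := hw
      refine lt_of_le_of_lt (Finset.sum_le_sum fun j _ => ?_) hw'
      simpa using Complex.abs_re_le_norm ((a j : ℂ) + w * ξ j)
  have hA : AnalyticOnNhd ℂ (fun w => (c : ℂ) * complexMGF Y (P.tilted f) w)
      {w : ℂ | ∑ j, ‖(a j : ℂ) + w * ξ j‖ < δ} := fun w hw =>
    analyticAt_const.mul (analyticAt_complexMGF (hstrip w hw))
  have hB := (hH a ξ).analyticOnNhd (isOpen_sum_norm_lt a ξ δ)
  have hfreq : ∃ᶠ w in 𝓝[≠] (0 : ℂ), (c : ℂ) * complexMGF Y (P.tilted f) w =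
      H (fun j => a j + w * ξ j) := by
    have hopen : IsOpen {s : ℝ | ∑ j, |a j + s * ξ j| < δ} :=
      isOpen_lt (by fun_prop) continuous_const
    have := frequently_nhdsNE_ofReal (x := 0) (p := fun w : ℂ =>
      (c : ℂ) * complexMGF Y (P.tilted f) w = H (fun j => a j + w * ξ j)) (by
        filter_upwards [hopen.mem_nhds (by simpa using haδ)] with s hs
        rw [htilt]
        have h1 := hreal (fun j => a j + s * ξ j) hs
        push_cast at h1
        rw [← h1, ← integral_complex_ofReal]
        push_cast
        rfl)
    simpa using this
  have := hA.eqOn_of_preconnected_of_frequently_eq hB (convex_sum_norm_lt a ξ δ).isPreconnected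
    h0 hfreq hI
  simp only [htilt, ← hzI] at this
  exact this

end MultiDim

section CumulantSeries

variable {Ω : Type*} [MeasurableSpace Ω] (P : Measure Ω) {d : ℕ} (X : Fin d → Ω → ℝ)

/-- The `r`-th cumulant of the complex linear combination `∑ z j * X j`, expanded
multilinearly in terms of the joint cumulants of `X`. -/
noncomputable def cumulantPoly (r : ℕ) (z : Fin d → ℂ) : ℂ :=
  ∑ i : Fin r → Fin d, (∏ k, z (i k)) * (jointCumulant P (fun k => X (i k)) : ℂ)

/-- The cumulant generating series. -/
noncomputable def cumulantSeries (z : Fin d → ℂ) : ℂ :=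
  ∑' r : ℕ, cumulantPoly P X r z / r.factorial

variable {P X}

lemma norm_cumulantPoly_le {r : ℕ} {M : ℝ}
    (h : ∀ i : Fin r → Fin d, |jointCumulant P (fun k => X (i k))| ≤ M) (z : Fin d → ℂ) :
    ‖cumulantPoly P X r z‖ ≤ M * (∑ j, ‖z j‖) ^ r := by
  refine (norm_sum_le _ _).trans ?_
  rw [Fintype.sum_pow, Finset.mul_sum]
  refine Finset.sum_le_sum fun i _ => ?_
  rw [norm_mul, norm_prod, Complex.norm_real, mul_comm, Real.norm_eq_abs]
  exact mul_le_mul_of_nonneg_right (h i) (Finset.prod_nonneg fun k _ => norm_nonneg _)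

lemma norm_cumulantPoly_div_le {m b : ℝ}
    (h : ∀ r, ∀ i : Fin r → Fin d, |jointCumulant P (fun k => X (i k))| ≤ m * b ^ r * r.factorial)
    (r : ℕ) (z : Fin d → ℂ) :
    ‖cumulantPoly P X r z / r.factorial‖ ≤ m * (b * ∑ j, ‖z j‖) ^ r := by
  have h1 := norm_cumulantPoly_le (h r) z
  have h2 : (0 : ℝ) < r.factorial := by positivity
  rw [norm_div, Complex.norm_natCast, div_le_iff₀ h2]
  refine h1.trans (le_of_eq ?_)
  rw [mul_pow]; ring

lemma differentiableOn_cumulantSeries {m b δ : ℝ} (hb : 0 ≤ b) (hm : 0 ≤ m) (hδ : 0 ≤ δ)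
    (hbδ : b * δ < 1)
    (h : ∀ r, ∀ i : Fin r → Fin d, |jointCumulant P (fun k => X (i k))| ≤ m * b ^ r * r.factorial)
    (a ξ : Fin d → ℝ) :
    DifferentiableOn ℂ (fun w : ℂ => cumulantSeries P X (fun j => a j + w * ξ j))
      {w : ℂ | ∑ j, ‖(a j : ℂ) + w * ξ j‖ < δ} := by
  unfold cumulantSeries
  refine Complex.differentiableOn_tsum_of_summable_norm (u := fun r => m * (b * δ) ^ r)
    ((summable_geometric_of_lt_one (by positivity) hbδ).mul_left m) (fun r => ?_)
    (isOpen_sum_norm_lt a ξ δ) (fun r w hw => ?_)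
  · unfold cumulantPoly
    fun_prop
  · have hw' : ∑ j, ‖(a j : ℂ) + w * ξ j‖ < δ := hw
    refine (norm_cumulantPoly_div_le h r _).trans ?_
    gcongr

lemma zero_mem_interior_integrableExpSet_linear_combination
    (h : ∀ᶠ z in 𝓝 (0 : Fin d → ℝ), Integrable (fun ω => Real.exp (∑ j, z j * X j ω)) P)
    (θ : Fin d → ℝ) :
    0 ∈ interior (integrableExpSet (fun ω => ∑ j, θ j * X j ω) P) := by
  rw [mem_interior_iff_mem_nhds]
  have hc : Tendsto (fun t : ℝ => t • θ) (𝓝 0) (𝓝 0) := by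
    have : Continuous (fun t : ℝ => t • θ) := by fun_prop
    simpa using this.tendsto 0
  filter_upwards [hc.eventually h] with t ht
  change Integrable _ _
  simpa only [Finset.mul_sum, Pi.smul_apply, smul_eq_mul, mul_assoc] using ht

variable [IsProbabilityMeasure P]

lemma eventually_mgf_eq_exp_cumulantSeries (hX : ∀ j, AEMeasurable (X j) P)
    (h : ∀ᶠ z in 𝓝 (0 : Fin d → ℝ), Integrable (fun ω => Real.exp (∑ j, z j * X j ω)) P)
    (θ : Fin d → ℝ) :
    ∀ᶠ t : ℝ in 𝓝 0, (mgf (fun ω => ∑ j, θ j * X j ω) P t : ℂ) =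
      Complex.exp (cumulantSeries P X (fun j => (t : ℂ) * θ j)) := by
  have h0 := zero_mem_interior_integrableExpSet_linear_combination h θ
  filter_upwards [(analyticAt_cgf h0).hasFPowerSeriesAt.eventually_hasSum,
    mem_interior_iff_mem_nhds.1 h0] with t ht hti
  have ht' : HasSum (fun r : ℕ => iteratedDeriv r (cgf (fun ω => ∑ j, θ j * X j ω) P) 0 /
      r.factorial * t ^ r) (cgf (fun ω => ∑ j, θ j * X j ω) P t) := by
    simpa [FormalMultilinearSeries.ofScalars_apply_eq, mul_comm] using ht
  have hpoly : ∀ r : ℕ, cumulantPoly P X r (fun j => (t : ℂ) * θ j) / r.factorial =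
      ((iteratedDeriv r (cgf (fun ω => ∑ j, θ j * X j ω) P) 0 / r.factorial * t ^ r : ℝ) : ℂ) := by
    intro r
    rw [iteratedDeriv_cgf_linear_combination hX h]
    unfold cumulantPoly
    push_cast
    simp only [Finset.prod_mul_distrib, Finset.prod_const, Finset.card_univ, Fintype.card_fin]
    rw [div_mul_eq_mul_div, Finset.sum_mul]
    congr 1
    exact Finset.sum_congr rfl fun i _ => by ring
  unfold cumulantSeries
  simp only [hpoly]
  rw [← Complex.ofReal_tsum, ht'.tsum_eq, ← Complex.ofReal_exp, exp_cgf hti]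

/-- If the joint cumulants grow at most like `b ^ r * r!`, then the complex Laplace transform is
the exponential of the cumulant series on the cross-polytope of radius `1 / b`. -/
theorem integral_cexp_eq_exp_cumulantSeries (hX : ∀ j, AEMeasurable (X j) P)
    (hint : ∀ᶠ z in 𝓝 (0 : Fin d → ℝ), Integrable (fun ω => Real.exp (∑ j, z j * X j ω)) P)
    {m b : ℝ} (hb : 0 ≤ b) (hm : 0 ≤ m)
    (h : ∀ r, ∀ i : Fin r → Fin d, |jointCumulant P (fun k => X (i k))| ≤ m * b ^ r * r.factorial) :
    (∀ θ : Fin d → ℝ, b * ∑ j, |θ j| < 1 →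
      Integrable (fun ω => Real.exp (∑ j, θ j * X j ω)) P) ∧
    ∀ z : Fin d → ℂ, b * ∑ j, ‖z j‖ < 1 →
      ∫ ω, Complex.exp (∑ j, z j * X j ω) ∂P = Complex.exp (cumulantSeries P X z) := by
  have hreal : ∀ θ : Fin d → ℝ, b * ∑ j, |θ j| < 1 →
      Integrable (fun ω => Real.exp (∑ j, θ j * X j ω)) P ∧
      ((∫ ω, Real.exp (∑ j, θ j * X j ω) ∂P : ℝ) : ℂ) =
        Complex.exp (cumulantSeries P X (fun j => θ j)) := by
    intro θ hθ
    set s := ∑ j, |θ j| with hs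
    have hs0 : 0 ≤ s := Finset.sum_nonneg fun j _ => abs_nonneg _
    have hbs : 0 ≤ b * s := by positivity
    set R : ℝ := 2 / (1 + b * s) with hR
    have hR1 : 1 < R := by rw [hR, lt_div_iff₀ (by positivity)]; linarith
    have hRb : b * (R * s) < 1 := by
      have : b * (R * s) = 2 * (b * s) / (1 + b * s) := by rw [hR]; ring
      rw [this, div_lt_one (by positivity)]; linarith
    obtain ⟨δ, hδ1, hδ2⟩ : ∃ δ, R * s < δ ∧ b * δ < 1 := by
      rcases hb.eq_or_lt with rfl | hb
      · exact ⟨R * s + 1, by linarith, by simp⟩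
      · obtain ⟨δ, h1, h2⟩ := exists_between (show R * s < 1 / b by
          rw [lt_div_iff₀ hb]; linarith)
        exact ⟨δ, h1, by rw [lt_div_iff₀ hb] at h2; linarith⟩
    have hδ0 : 0 ≤ δ := le_trans (by positivity) hδ1.le
    have hY : AEMeasurable (fun ω => ∑ j, θ j * X j ω) P :=
      Finset.aemeasurable_fun_sum _ fun j _ => (hX j).const_mul (θ j)
    have h0 := zero_mem_interior_integrableExpSet_linear_combination hint θ
    have hH : DifferentiableOn ℂ (fun w : ℂ => Complex.exp (cumulantSeries P X
        (fun j => w * θ j))) (Metric.ball 0 R) := by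
      have := (differentiableOn_cumulantSeries hb hm hδ0 hδ2 h 0 θ).cexp
      simp only [Pi.zero_apply, Complex.ofReal_zero, zero_add] at this
      refine this.mono fun w hw => ?_
      change ∑ j, ‖w * θ j‖ < δ
      simp only [norm_mul, ← Finset.mul_sum, Complex.norm_real, Real.norm_eq_abs]
      refine lt_of_le_of_lt (mul_le_mul_of_nonneg_right ?_ hs0) hδ1
      exact (mem_ball_zero_iff.1 hw).le
    have hm' := eventually_mgf_eq_exp_cumulantSeries hX hint θ
    have h1 : |(1 : ℝ)| < R := by simpa using hR1
    constructor
    · simpa using integrable_exp_mul_of_mgf_extends hY h0 hH hm' h1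
    · simpa [mgf] using mgf_eq_of_mgf_extends hY h0 hH hm' h1
  refine ⟨fun θ hθ => (hreal θ hθ).1, fun z hz => ?_⟩
  have hs0 : 0 ≤ ∑ j, ‖z j‖ := Finset.sum_nonneg fun j _ => norm_nonneg _
  obtain ⟨δ, hδ1, hδ2⟩ : ∃ δ, ∑ j, ‖z j‖ < δ ∧ b * δ < 1 := by
    rcases hb.eq_or_lt with rfl | hb
    · exact ⟨∑ j, ‖z j‖ + 1, by linarith, by simp⟩
    · obtain ⟨δ, h1, h2⟩ := exists_between (show ∑ j, ‖z j‖ < 1 / b by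
        rw [lt_div_iff₀ hb]; linarith)
      exact ⟨δ, h1, by rw [lt_div_iff₀ hb] at h2; linarith⟩
  have hlt : ∀ θ : Fin d → ℝ, ∑ j, |θ j| < δ → b * ∑ j, |θ j| < 1 := fun θ hθ =>
    (mul_le_mul_of_nonneg_left hθ.le hb).trans_lt hδ2
  exact integral_cexp_eq_of_real (H := fun z => Complex.exp (cumulantSeries P X z))
    (fun a ξ => (differentiableOn_cumulantSeries hb hm (hs0.trans hδ1.le) hδ2 h a ξ).cexp)
    (fun θ hθ => (hreal θ (hlt θ hθ)).1) (fun θ hθ => (hreal θ (hlt θ hθ)).2) hδ1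

end CumulantSeries

section QuadraticForm

variable {d : ℕ}

/-- The complexified quadratic form of a real matrix. -/
noncomputable def complexQuadForm (K : Matrix (Fin d) (Fin d) ℝ) (z : Fin d → ℂ) : ℂ :=
  ∑ i, ∑ j, z i * z j * K i j

lemma complexQuadForm_ofReal (K : Matrix (Fin d) (Fin d) ℝ) (x : Fin d → ℝ) :
    complexQuadForm K (fun j => x j) = ((∑ i, ∑ j, x i * x j * K i j : ℝ) : ℂ) := by
  unfold complexQuadForm; push_cast; rfl

lemma dotProduct_mulVec_eq_sum (K : Matrix (Fin d) (Fin d) ℝ) (x : Fin d → ℝ) :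
    x ⬝ᵥ K.mulVec x = ∑ i, ∑ j, x i * x j * K i j := by
  simp only [dotProduct, Matrix.mulVec, Finset.mul_sum]
  exact Finset.sum_congr rfl fun i _ => Finset.sum_congr rfl fun j _ => by ring

lemma exists_pos_le_quadForm {K : Matrix (Fin d) (Fin d) ℝ} (hK : K.PosDef) :
    ∃ l : ℝ, 0 < l ∧ ∀ x : EuclideanSpace ℝ (Fin d),
      l * ‖x‖ ^ 2 ≤ ∑ i, ∑ j, x i * x j * K i j := by
  set Q : EuclideanSpace ℝ (Fin d) → ℝ := fun x => ∑ i, ∑ j, x i * x j * K i j with hQ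
  have hpos : ∀ x : EuclideanSpace ℝ (Fin d), x ≠ 0 → 0 < Q x := by
    intro x hx
    have := hK.dotProduct_mulVec_pos (x := x.ofLp) (by
      intro h; exact hx (by ext j; simpa using congrFun h j))
    rwa [star_trivial, dotProduct_mulVec_eq_sum] at this
  have hcont : Continuous Q := by fun_prop
  rcases (Metric.sphere (0 : EuclideanSpace ℝ (Fin d)) 1).eq_empty_or_nonempty with he | hne
  · refine ⟨1, one_pos, fun x => ?_⟩
    have hx : x = 0 := by
      by_contra hx
      have : (‖x‖⁻¹ • x) ∈ Metric.sphere (0 : EuclideanSpace ℝ (Fin d)) 1 := by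
        rw [mem_sphere_zero_iff_norm, norm_smul, norm_inv, norm_norm,
          inv_mul_cancel₀ (norm_ne_zero_iff.2 hx)]
      rw [he] at this; exact this
    simp [hx]
  · obtain ⟨x0, hx0, hmin⟩ := (isCompact_sphere (0 : EuclideanSpace ℝ (Fin d)) 1).exists_isMinOn
      hne hcont.continuousOn
    refine ⟨Q x0, hpos x0 (by rintro rfl; simp at hx0), fun x => ?_⟩
    rcases eq_or_ne x 0 with rfl | hx
    · simp
    have hn : ‖x‖ ≠ 0 := norm_ne_zero_iff.2 hx
    have h1 : Q x0 ≤ Q (‖x‖⁻¹ • x) := hmin (by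
      rw [mem_sphere_zero_iff_norm, norm_smul, norm_inv, norm_norm, inv_mul_cancel₀ hn])
    have h2 : Q (‖x‖⁻¹ • x) = (‖x‖ ^ 2)⁻¹ * Q x := by
      simp only [hQ, PiLp.smul_apply, smul_eq_mul, Finset.mul_sum]
      exact Finset.sum_congr rfl fun i _ => Finset.sum_congr rfl fun j _ => by
        field_simp
    rw [h2, inv_mul_eq_div, le_div_iff₀ (by positivity)] at h1
    exact h1

lemma norm_sum_sum_mul_le {M : Matrix (Fin d) (Fin d) ℂ} {m : ℝ} (hM : ∀ i j, ‖M i j‖ ≤ m)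
    (z : Fin d → ℂ) : ‖∑ i, ∑ j, z i * z j * M i j‖ ≤ m * (∑ j, ‖z j‖) ^ 2 := by
  rw [sq, Finset.sum_mul_sum, Finset.mul_sum]
  refine (norm_sum_le _ _).trans (Finset.sum_le_sum fun i _ => ?_)
  rw [Finset.mul_sum]
  refine (norm_sum_le _ _).trans (Finset.sum_le_sum fun j _ => ?_)
  rw [norm_mul, norm_mul, mul_comm m]
  exact mul_le_mul_of_nonneg_left (hM i j) (by positivity)

lemma re_complexQuadForm_add_I_mul {K : Matrix (Fin d) (Fin d) ℝ} (a η : Fin d → ℝ) :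
    (complexQuadForm K (fun j => a j + Complex.I * η j)).re =
      (∑ i, ∑ j, a i * a j * K i j) - ∑ i, ∑ j, η i * η j * K i j := by
  unfold complexQuadForm
  simp only [Complex.re_sum, ← Finset.sum_sub_distrib]
  refine Finset.sum_congr rfl fun i _ => Finset.sum_congr rfl fun j _ => ?_
  simp [Complex.mul_re, Complex.mul_im]
  ring

end QuadraticForm

section Gaussian

variable {d : ℕ} {K : Matrix (Fin d) (Fin d) ℝ}

lemma multivariateGaussian_exp (hK : K.PosSemidef) (θ : Fin d → ℝ) :
    Integrable (fun x : EuclideanSpace ℝ (Fin d) => Real.exp (∑ j, θ j * x j))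
      (multivariateGaussian 0 K) ∧
    ∫ x : EuclideanSpace ℝ (Fin d), Real.exp (∑ j, θ j * x j) ∂(multivariateGaussian 0 K) =
      Real.exp ((∑ i, ∑ j, θ i * θ j * K i j) / 2) := by
  set G := multivariateGaussian (0 : EuclideanSpace ℝ (Fin d)) K with hG
  set L : StrongDual ℝ (EuclideanSpace ℝ (Fin d)) := innerSL ℝ (WithLp.toLp 2 θ) with hL
  have hLx : ∀ x, L x = ∑ j, θ j * x j := fun x => by
    rw [hL, innerSL_apply_apply, PiLp.inner_apply]
    exact Finset.sum_congr rfl fun j _ => by simp [mul_comm]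
  have hvar : Var[L; G] = ∑ i, ∑ j, θ i * θ j * K i j := by
    have h1 := covarianceBilin_self (μ := G) IsGaussian.memLp_two_id (WithLp.toLp 2 θ)
    rw [hG, covarianceBilin_multivariateGaussian hK, dotProduct_mulVec_eq_sum] at h1
    exact h1.symm
  have hmean : G[L] = 0 := by
    have := ContinuousLinearMap.integral_comp_id_comm (μ := G) IsGaussian.integrable_id L
    rw [this, hG, integral_id_multivariateGaussian, map_zero]
  have hmap : G.map L = gaussianReal 0 (Var[L; G]).toNNReal := by
    rw [IsGaussian.map_eq_gaussianReal L, hmean]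
  have hv0 : 0 ≤ ∑ i, ∑ j, θ i * θ j * K i j := by
    rw [← hvar]; exact variance_nonneg _ _
  have hmgf := mgf_gaussianReal hmap 1
  rw [hvar, Real.coe_toNNReal _ hv0] at hmgf
  simp only [mgf, one_mul, hLx, zero_add, one_pow, mul_one] at hmgf
  refine ⟨?_, hmgf⟩
  have hi := integrable_exp_mul_gaussianReal (μ := 0) (v := (Var[L; G]).toNNReal) 1
  rw [← hmap, integrable_map_measure (by fun_prop) (by fun_prop)] at hi
  refine hi.congr (Eventually.of_forall fun x => ?_)
  simp [hLx]

/-- The complex Laplace transform of a centred Gaussian vector. -/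
lemma multivariateGaussian_cexp (hK : K.PosSemidef) (z : Fin d → ℂ) :
    ∫ x : EuclideanSpace ℝ (Fin d), Complex.exp (∑ j, z j * x j) ∂(multivariateGaussian 0 K) =
      Complex.exp (complexQuadForm K z / 2) := by
  refine integral_cexp_eq_of_real (X := fun j (x : EuclideanSpace ℝ (Fin d)) => x j)
    (δ := ∑ j, ‖z j‖ + 1) (H := fun z => Complex.exp (complexQuadForm K z / 2))
    (fun a ξ => ?_) (fun θ _ => (multivariateGaussian_exp hK θ).1) (fun θ _ => ?_) (by linarith)
  · unfold complexQuadForm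
    fun_prop
  · rw [(multivariateGaussian_exp hK θ).2, complexQuadForm_ofReal]
    push_cast
    rfl

end Gaussian

section Remainder

variable {Ω : Type*} [MeasurableSpace Ω] {P : Measure Ω} [IsProbabilityMeasure P] {d : ℕ}
  {X : Fin d → Ω → ℝ}

lemma jointCumulant_zero (Y : Fin 0 → Ω → ℝ) : jointCumulant P Y = 0 := by
  simp [jointCumulant]

lemma jointCumulant_one (hX : ∀ j, AEMeasurable (X j) P)
    (hint : ∀ᶠ z in 𝓝 (0 : Fin d → ℝ), Integrable (fun ω => Real.exp (∑ j, z j * X j ω)) P)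
    (i : Fin 1 → Fin d) : jointCumulant P (fun k => X (i k)) = ∫ ω, X (i 0) ω ∂P := by
  have h1 := iteratedDeriv_cgf_linear_combination hX hint 1 (Pi.single (i 0) 1)
  rw [iteratedDeriv_one,
    deriv_cgf_zero (zero_mem_interior_integrableExpSet_linear_combination hint _)] at h1
  rw [Finset.sum_eq_single i] at h1
  · simpa [Pi.single_apply] using h1.symm
  · intro b _ hb
    have : b 0 ≠ i 0 := fun h => hb (funext fun k => by rw [Subsingleton.elim k 0, h])
    simp [Pi.single_apply, this]
  · simp

lemma norm_cumulantSeries_sub_le (hX : ∀ j, AEMeasurable (X j) P)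
    (hint : ∀ᶠ z in 𝓝 (0 : Fin d → ℝ), Integrable (fun ω => Real.exp (∑ j, z j * X j ω)) P)
    (hmean : ∀ j, ∫ ω, X j ω ∂P = 0) {p q : ℝ} (hp : 0 ≤ p) (hq : 0 ≤ q)
    (h : ∀ r, 3 ≤ r → ∀ i : Fin r → Fin d,
      |jointCumulant P (fun k => X (i k))| ≤ q * p ^ r * r.factorial)
    {z : Fin d → ℂ} (hz : p * ∑ j, ‖z j‖ ≤ 1 / 2) :
    ‖cumulantSeries P X z - (∑ i, ∑ j, z i * z j * (jointCumulant P ![X i, X j] : ℂ)) / 2‖ ≤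
      2 * q * (p * ∑ j, ‖z j‖) ^ 3 := by
  set s := ∑ j, ‖z j‖ with hs
  have hs0 : 0 ≤ s := Finset.sum_nonneg fun j _ => norm_nonneg _
  have hterm : ∀ r : ℕ, ‖cumulantPoly P X (r + 3) z / (r + 3).factorial‖ ≤
      q * (p * s) ^ 3 * (1 / 2) ^ r := by
    intro r
    have h1 := norm_cumulantPoly_le (h (r + 3) (by omega)) z
    have h2 : (0 : ℝ) < (r + 3).factorial := by positivity
    rw [norm_div, Complex.norm_natCast, div_le_iff₀ h2]
    refine h1.trans ?_
    have h3 : (p * s) ^ r ≤ (1 / 2) ^ r := pow_le_pow_left₀ (by positivity) hz r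
    calc q * p ^ (r + 3) * (r + 3).factorial * s ^ (r + 3)
        = q * (p * s) ^ 3 * (p * s) ^ r * (r + 3).factorial := by rw [mul_pow, mul_pow]; ring
      _ ≤ _ := by gcongr
  have hgeo : Summable (fun r : ℕ => q * (p * s) ^ 3 * (1 / 2 : ℝ) ^ r) :=
    (summable_geometric_of_lt_one (by norm_num) (by norm_num)).mul_left _
  have hsum3 : Summable (fun r : ℕ => cumulantPoly P X (r + 3) z / (r + 3).factorial) :=
    Summable.of_norm_bounded hgeo hterm
  have hsum : Summable (fun r : ℕ => cumulantPoly P X r z / r.factorial) :=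
    (summable_nat_add_iff 3).1 hsum3
  have h0 : cumulantPoly P X 0 z = 0 := by simp [cumulantPoly, jointCumulant_zero]
  have h1 : cumulantPoly P X 1 z = 0 := by
    unfold cumulantPoly
    refine Finset.sum_eq_zero fun i _ => ?_
    rw [jointCumulant_one hX hint, hmean]; simp
  have h2 : cumulantPoly P X 2 z = ∑ i, ∑ j, z i * z j * (jointCumulant P ![X i, X j] : ℂ) := by
    unfold cumulantPoly
    rw [← (finTwoArrowEquiv (Fin d)).symm.sum_comp, Fintype.sum_prod_type]
    refine Finset.sum_congr rfl fun i _ => Finset.sum_congr rfl fun j _ => ?_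
    have : (fun k => X ((finTwoArrowEquiv (Fin d)).symm (i, j) k)) = ![X i, X j] := by
      funext k; fin_cases k <;> rfl
    rw [this, Fin.prod_univ_two]
    rfl
  have hsplit : cumulantSeries P X z - (∑ i, ∑ j, z i * z j *
      (jointCumulant P ![X i, X j] : ℂ)) / 2 =
      ∑' r : ℕ, cumulantPoly P X (r + 3) z / (r + 3).factorial := by
    unfold cumulantSeries
    rw [← hsum.sum_add_tsum_nat_add 3, ← h2]
    simp [Finset.sum_range_succ, h0, h1]
  rw [hsplit]
  refine (tsum_of_norm_bounded (hgeo.hasSum) hterm).trans ?_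
  rw [tsum_mul_left, tsum_geometric_of_lt_one (by norm_num) (by norm_num)]
  norm_num
  linarith [show q * (p * s) ^ 3 * 2 = 2 * q * (p * s) ^ 3 by ring]

end Remainder

section LaplaceDifference

lemma norm_cexp_add_sub_le (u v : ℂ) :
    ‖Complex.exp (u + v) - Complex.exp u‖ ≤ Real.exp u.re * (‖v‖ * Real.exp ‖v‖) := by
  have h := Complex.norm_exp_sub_sum_le_norm_mul_exp v 1
  simp only [Finset.sum_range_one, pow_zero, Nat.factorial_zero, Nat.cast_one, div_one,
    pow_one] at h
  have : Complex.exp (u + v) - Complex.exp u = Complex.exp u * (Complex.exp v - 1) := by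
    rw [Complex.exp_add]; ring
  rw [this, norm_mul, Complex.norm_exp]
  gcongr

lemma pow_sub_two_le_exp_mul_factorial (r : ℕ) :
    (r : ℝ) ^ (r - 2) ≤ Real.exp 1 ^ r * r.factorial := by
  rcases Nat.eq_zero_or_pos r with rfl | hr
  · simp
  have h1 : (1 : ℝ) ≤ r := by exact_mod_cast hr
  have h2 := Real.pow_div_factorial_le_exp (x := (r : ℝ)) (by positivity) r
  rw [div_le_iff₀ (by positivity)] at h2
  calc (r : ℝ) ^ (r - 2) ≤ (r : ℝ) ^ r := pow_le_pow_right₀ h1 (by omega)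
    _ ≤ _ := h2
    _ = _ := by rw [← Real.exp_nat_mul, mul_one]

lemma exists_one_add_pow_mul_exp_neg_le {c : ℝ} (hc : 0 < c) (m : ℕ) :
    ∃ C : ℝ, 0 < C ∧ ∀ t : ℝ, 0 ≤ t → (1 + t) ^ m * Real.exp (-(c * t ^ 2)) ≤ C := by
  refine ⟨m.factorial / c ^ m * Real.exp (2 * c), by positivity, fun t ht => ?_⟩
  have h1 := Real.pow_div_factorial_le_exp (x := c * (1 + t)) (by positivity) m
  rw [div_le_iff₀ (by positivity), mul_pow] at h1
  have h2 : (1 + t) ^ m ≤ m.factorial / c ^ m * Real.exp (c * (1 + t)) := by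
    rw [div_mul_eq_mul_div, le_div_iff₀ (by positivity)]
    linarith
  calc (1 + t) ^ m * Real.exp (-(c * t ^ 2))
      ≤ m.factorial / c ^ m * Real.exp (c * (1 + t)) * Real.exp (-(c * t ^ 2)) := by gcongr
    _ = m.factorial / c ^ m * Real.exp (c * (1 + t) - c * t ^ 2) := by
        rw [mul_assoc, ← Real.exp_add]; ring_nf
    _ ≤ _ := by
        gcongr
        nlinarith [mul_nonneg hc.le (sq_nonneg (t - 1 / 2))]

universe u

set_option maxHeartbeats 1000000 in
/-- On the vertical lines through the sign vectors, up to frequencies of order `√(N / D)`, the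
Laplace transform of the rescaled vector is close to that of the Gaussian. -/
theorem exists_laplace_diff_bound {d : ℕ} {K : Matrix (Fin d) (Fin d) ℝ} (hK : K.PosDef)
    {A : ℝ} (B : ℝ) (hA : 0 < A) :
    ∃ ρ C : ℝ, 0 < ρ ∧ 0 < C ∧ ∀ {Ω : Type u} [MeasurableSpace Ω] (P : Measure Ω)
      [IsProbabilityMeasure P] (X : Fin d → Ω → ℝ) (N D : ℝ), 0 < N → 0 < D →
      (∀ j, AEMeasurable (X j) P) →
      (∀ᶠ z in 𝓝 (0 : Fin d → ℝ), Integrable (fun ω => Real.exp (∑ j, z j * X j ω)) P) →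
      (∀ j, ∫ ω, X j ω ∂P = 0) →
      (∀ i j, ∃ δ : ℝ, |δ| ≤ B * √(D / N) ∧
        jointCumulant P ![X i, X j] = N * D * K i j * (1 + δ)) →
      (∀ r : ℕ, 3 ≤ r → ∀ i : Fin r → Fin d, |jointCumulant P (fun k => X (i k))| ≤
        N * (2 * D) ^ (r - 1) * A ^ r * (r : ℝ) ^ (r - 2)) →
      √(D / N) ≤ ρ → ∀ σ : Fin d → Bool,
        Integrable (fun ω => Real.exp (∑ j, signVec σ j * ((√(N * D))⁻¹ * X j ω))) P ∧
        ∀ η : EuclideanSpace ℝ (Fin d), √(D / N) * ‖η‖ ≤ ρ →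
          ‖∫ ω, Complex.exp (∑ j, (signVec σ j + Complex.I * η j) *
                (((√(N * D))⁻¹ * X j ω : ℝ) : ℂ)) ∂P -
            ∫ x : EuclideanSpace ℝ (Fin d), Complex.exp (∑ j, (signVec σ j + Complex.I * η j) *
                (x j : ℂ)) ∂(multivariateGaussian 0 K)‖
            ≤ C * √(D / N) / (1 + ‖η‖) ^ (d + 1) := by
  obtain ⟨l, hl, hlQ⟩ := exists_pos_le_quadForm hK
  obtain ⟨C5, hC5, hC5b⟩ := exists_one_add_pow_mul_exp_neg_le (c := l / 4) (by positivity) (d + 4)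
  set k : ℝ := ∑ i, ∑ j, |K i j| with hk
  have hk0 : 0 ≤ k := Finset.sum_nonneg fun i _ => Finset.sum_nonneg fun j _ => abs_nonneg _
  have hkij : ∀ i j, |K i j| ≤ k := fun i j =>
    (Finset.single_le_sum (f := fun j => |K i j|) (fun _ _ => abs_nonneg _)
      (Finset.mem_univ j)).trans (Finset.single_le_sum (f := fun i => ∑ j, |K i j|)
        (fun _ _ => Finset.sum_nonneg fun j _ => abs_nonneg _) (Finset.mem_univ i))
  set e := Real.exp 1 with he
  have he0 : 0 < e := Real.exp_pos 1
  set C2 : ℝ := k * |B| * d ^ 2 / 2 + (2 * e * A * d) ^ 3 with hC2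
  have hC20 : 0 ≤ C2 := by positivity
  set ρ : ℝ := min (1 / (8 * e * A * (d + 1))) (l / (16 * (C2 + 1))) with hρ
  have hρ1 : 8 * e * A * (d + 1) * ρ ≤ 1 := by
    have : ρ ≤ 1 / (8 * e * A * (d + 1)) := min_le_left _ _
    rw [le_div_iff₀ (by positivity)] at this; linarith
  have hρ2 : 16 * (C2 + 1) * ρ ≤ l := by
    have : ρ ≤ l / (16 * (C2 + 1)) := min_le_right _ _
    rw [le_div_iff₀ (by positivity)] at this; linarith
  have hρ0 : 0 < ρ := lt_min (by positivity) (by positivity)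
  refine ⟨ρ, Real.exp (k / 2 + l / 4) * (C2 + 1) * C5, hρ0, by positivity, ?_⟩
  intro Ω _ P _ X N D hN hD hX hint hmean hcov hhigh hε σ
  set ε := √(D / N) with hεdef
  have hε0 : 0 < ε := Real.sqrt_pos.2 (by positivity)
  have hε2 : ε ^ 2 = D / N := Real.sq_sqrt (by positivity)
  set c := (√(N * D))⁻¹ with hc
  have hsq : √(N * D) ^ 2 = N * D := Real.sq_sqrt (by positivity)
  have hsq0 : 0 < √(N * D) := Real.sqrt_pos.2 (by positivity)
  have hc0 : 0 < c := inv_pos.2 hsq0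
  have hc2 : c ^ 2 * (N * D) = 1 := by rw [hc, inv_pow, hsq]; field_simp
  have hDc : D * c = ε := by
    rw [← sq_eq_sq₀ (by positivity) hε0.le, mul_pow, hε2, hc, inv_pow, hsq]
    field_simp
  set p : ℝ := 2 * e * D * A with hp
  set q : ℝ := N / (2 * D) with hq
  have hp0 : 0 < p := by positivity
  have hq0 : 0 < q := by positivity
  have hpc : p * c = 2 * e * A * ε := by rw [hp, ← hDc]; ring
  have hhigh' : ∀ r, 3 ≤ r → ∀ i : Fin r → Fin d,
      |jointCumulant P (fun k => X (i k))| ≤ q * p ^ r * r.factorial := by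
    intro r hr i
    refine (hhigh r hr i).trans ?_
    have h1 := pow_sub_two_le_exp_mul_factorial r
    obtain ⟨s, rfl⟩ : ∃ s, r = s + 1 := ⟨r - 1, by omega⟩
    have h2 : q * p ^ (s + 1) * (s + 1).factorial =
        N * (2 * D) ^ (s + 1 - 1) * A ^ (s + 1) * (e ^ (s + 1) * (s + 1).factorial) := by
      rw [hq, hp, Nat.add_sub_cancel, show 2 * e * D * A = (2 * D) * A * e by ring, mul_pow,
        mul_pow, pow_succ (2 * D)]
      field_simp
    rw [h2]
    gcongr
  set T : ℝ := ∑ i, ∑ j, |jointCumulant P ![X i, X j]| with hT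
  have hT0 : 0 ≤ T := Finset.sum_nonneg fun i _ => Finset.sum_nonneg fun j _ => abs_nonneg _
  have hall : ∀ r, ∀ i : Fin r → Fin d,
      |jointCumulant P (fun k => X (i k))| ≤ (q + T / (2 * p ^ 2)) * p ^ r * r.factorial := by
    intro r i
    have hm0 : 0 ≤ q + T / (2 * p ^ 2) := by positivity
    rcases Nat.lt_or_ge r 3 with hr | hr
    · interval_cases r
      · rw [jointCumulant_zero, abs_zero]; positivity
      · rw [jointCumulant_one hX hint, hmean, abs_zero]; positivity
      · have h1 : (fun k => X (i k)) = ![X (i 0), X (i 1)] := by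
          funext k; fin_cases k <;> rfl
        rw [h1]
        have h2 : |jointCumulant P ![X (i 0), X (i 1)]| ≤ T :=
          (Finset.single_le_sum (f := fun j => |jointCumulant P ![X (i 0), X j]|)
            (fun _ _ => abs_nonneg _) (Finset.mem_univ (i 1))).trans
            (Finset.single_le_sum (f := fun i => ∑ j, |jointCumulant P ![X i, X j]|)
              (fun _ _ => Finset.sum_nonneg fun j _ => abs_nonneg _) (Finset.mem_univ (i 0)))
        refine h2.trans ?_
        have h3 : (q + T / (2 * p ^ 2)) * p ^ 2 * (Nat.factorial 2 : ℕ) = 2 * q * p ^ 2 + T := by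
          rw [Nat.factorial_two]; push_cast; field_simp
        rw [h3]
        have : 0 ≤ 2 * q * p ^ 2 := by positivity
        linarith
    · refine (hhigh' r hr i).trans ?_
      gcongr
      exact le_add_of_nonneg_right (by positivity)
  obtain ⟨hreal, hcplx⟩ := integral_cexp_eq_exp_cumulantSeries hX hint hp0.le
    (show 0 ≤ q + T / (2 * p ^ 2) by positivity) hall
  constructor
  · have := hreal (fun j => c * signVec σ j) (by
      simp only [abs_mul, abs_signVec, mul_one, Finset.sum_const, Finset.card_univ,
        Fintype.card_fin, abs_of_pos hc0, nsmul_eq_mul]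
      have h1 : p * (d * c) = 2 * e * A * d * ε := by rw [mul_left_comm, hpc]; ring
      rw [h1]
      calc 2 * e * A * d * ε ≤ 2 * e * A * d * ρ := by gcongr
        _ < 8 * e * A * (d + 1) * ρ := by
          have h2 : 0 < e * A * ρ := by positivity
          have h3 : 0 ≤ e * A * d * ρ := by positivity
          linarith
        _ ≤ 1 := hρ1)
    refine this.congr (Eventually.of_forall fun ω => ?_)
    simp only []
    congr 1
    exact Finset.sum_congr rfl fun j _ => by ring
  intro η hη
  set t := ‖η‖ with ht
  have ht0 : 0 ≤ t := norm_nonneg η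
  set z : Fin d → ℂ := fun j => (signVec σ j : ℂ) + Complex.I * η j with hz
  set s := ∑ j, ‖z j‖ with hs
  have hs0 : 0 ≤ s := Finset.sum_nonneg fun j _ => norm_nonneg _
  have hst : s ≤ d * (1 + t) := by
    have : ∀ j ∈ Finset.univ, ‖z j‖ ≤ 1 + t := by
      intro j _
      refine (norm_add_le _ _).trans ?_
      rw [norm_mul, Complex.norm_I, one_mul, Complex.norm_real, Complex.norm_real,
        Real.norm_eq_abs, abs_signVec]
      gcongr
      exact PiLp.norm_apply_le η j
    have h1 := Finset.sum_le_card_nsmul _ _ _ this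
    rwa [Finset.card_univ, Fintype.card_fin, nsmul_eq_mul] at h1
  have hεt : ε * (1 + t) ≤ 2 * ρ := by rw [mul_add, mul_one]; linarith
  set Z : Fin d → ℂ := fun j => (c : ℂ) * z j with hZ
  have hZs : ∑ j, ‖Z j‖ = c * s := by
    simp only [hZ, norm_mul, Complex.norm_real, Real.norm_of_nonneg hc0.le, ← Finset.mul_sum, hs]
  have hpZ : p * ∑ j, ‖Z j‖ = 2 * e * A * (ε * s) := by rw [hZs, ← mul_assoc, hpc]; ring
  have hεs : ε * s ≤ d * (2 * ρ) := by
    calc ε * s ≤ ε * (d * (1 + t)) := by gcongr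
      _ = d * (ε * (1 + t)) := by ring
      _ ≤ _ := by gcongr
  have hpZ2 : p * ∑ j, ‖Z j‖ ≤ 1 / 2 := by
    rw [hpZ]
    have : 2 * e * A * (ε * s) ≤ 2 * e * A * (d * (2 * ρ)) := by gcongr
    have h2 : 0 < e * A * ρ := by positivity
    linarith
  have hR := norm_cumulantSeries_sub_le hX hint hmean hp0.le hq0.le hhigh' hpZ2
  choose δ hδ hκ using hcov
  set v : ℂ := cumulantSeries P X Z - complexQuadForm K z / 2 with hv
  have hquad : (∑ i, ∑ j, Z i * Z j * (jointCumulant P ![X i, X j] : ℂ)) / 2 -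
      complexQuadForm K z / 2 = (∑ i, ∑ j, z i * z j * ((K i j * δ i j : ℝ) : ℂ)) / 2 := by
    rw [← sub_div]
    congr 1
    unfold complexQuadForm
    rw [← Finset.sum_sub_distrib]
    refine Finset.sum_congr rfl fun i _ => ?_
    rw [← Finset.sum_sub_distrib]
    refine Finset.sum_congr rfl fun j _ => ?_
    rw [hκ, hZ]
    have hc2' : (c : ℂ) ^ 2 * (N * D) = 1 := by exact_mod_cast hc2
    push_cast
    linear_combination (z i * z j * K i j * (1 + δ i j)) * hc2'
  have hvb : ‖v‖ ≤ ε * C2 * (1 + t) ^ 3 := by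
    have h1 : v = (cumulantSeries P X Z -
        (∑ i, ∑ j, Z i * Z j * (jointCumulant P ![X i, X j] : ℂ)) / 2) +
        (∑ i, ∑ j, z i * z j * ((K i j * δ i j : ℝ) : ℂ)) / 2 := by
      rw [← hquad, hv]; ring
    have h2 : ‖∑ i, ∑ j, z i * z j * ((K i j * δ i j : ℝ) : ℂ)‖ ≤ k * (|B| * ε) * s ^ 2 := by
      refine norm_sum_sum_mul_le (M := Matrix.of fun i j => ((K i j * δ i j : ℝ) : ℂ))
        (fun i j => ?_) z
      rw [Matrix.of_apply, Complex.norm_real, Real.norm_eq_abs, abs_mul]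
      refine mul_le_mul (hkij i j) ((hδ i j).trans ?_) (abs_nonneg _) hk0
      gcongr
      exact le_abs_self B
    have h3 : 2 * q * (p * ∑ j, ‖Z j‖) ^ 3 = ε * (2 * e * A * s) ^ 3 := by
      have : 2 * q * ε ^ 2 = 1 := by rw [hq, hε2]; field_simp
      rw [hpZ]
      linear_combination (ε * (2 * e * A * s) ^ 3) * this
    rw [h1]
    refine (norm_add_le _ _).trans ?_
    rw [norm_div, RCLike.norm_ofNat]
    rw [h3] at hR
    have h4 : s ^ 2 ≤ d ^ 2 * (1 + t) ^ 3 := by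
      calc s ^ 2 ≤ (d * (1 + t)) ^ 2 := by gcongr
        _ = d ^ 2 * (1 + t) ^ 2 := by ring
        _ ≤ d ^ 2 * (1 + t) ^ 3 := by
          gcongr
          · linarith
          · norm_num
    have h5 : (2 * e * A * s) ^ 3 ≤ (2 * e * A * d) ^ 3 * (1 + t) ^ 3 := by
      rw [← mul_pow, mul_assoc (2 * e * A)]
      gcongr
    calc _ ≤ ε * (2 * e * A * s) ^ 3 + k * (|B| * ε) * s ^ 2 / 2 := by gcongr
      _ ≤ ε * ((2 * e * A * d) ^ 3 * (1 + t) ^ 3) +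
          k * (|B| * ε) * (d ^ 2 * (1 + t) ^ 3) / 2 := by gcongr
      _ = _ := by rw [hC2]; ring
  have hvb2 : ‖v‖ ≤ l / 4 + l / 4 * t ^ 2 := by
    refine hvb.trans ?_
    calc ε * C2 * (1 + t) ^ 3 = C2 * (ε * (1 + t)) * (1 + t) ^ 2 := by ring
      _ ≤ C2 * (2 * ρ) * (2 * (1 + t ^ 2)) := by
        gcongr
        nlinarith [sq_nonneg (1 - t)]
      _ = 4 * C2 * ρ * (1 + t ^ 2) := by ring
      _ ≤ l / 4 * (1 + t ^ 2) := by
        gcongr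
        linarith
      _ = _ := by ring
  have hre : (complexQuadForm K z / 2).re ≤ k / 2 - l / 2 * t ^ 2 := by
    have h1 : (complexQuadForm K z / 2).re = (complexQuadForm K z).re / 2 := by
      rw [show (2 : ℂ) = ((2 : ℝ) : ℂ) by norm_num, Complex.div_ofReal_re]
    rw [h1, hz, re_complexQuadForm_add_I_mul]
    have h2 : ∑ i, ∑ j, signVec σ i * signVec σ j * K i j ≤ k := by
      refine Finset.sum_le_sum fun i _ => Finset.sum_le_sum fun j _ => ?_
      refine (le_abs_self _).trans ?_
      rw [abs_mul, abs_mul, abs_signVec, abs_signVec, one_mul, one_mul]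
    have h3 := hlQ η
    linarith
  have hL : ∫ ω, Complex.exp (∑ j, z j * ((c * X j ω : ℝ) : ℂ)) ∂P =
      Complex.exp (complexQuadForm K z / 2 + v) := by
    have h1 := hcplx Z (by linarith)
    rw [hv, add_sub_cancel, ← h1]
    refine integral_congr_ae (Eventually.of_forall fun ω => ?_)
    simp only []
    congr 1
    refine Finset.sum_congr rfl fun j _ => ?_
    rw [hZ]; push_cast; ring
  rw [hL, multivariateGaussian_cexp hK.posSemidef]
  refine (norm_cexp_add_sub_le _ _).trans ?_
  rw [le_div_iff₀ (by positivity)]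
  calc Real.exp (complexQuadForm K z / 2).re * (‖v‖ * Real.exp ‖v‖) * (1 + t) ^ (d + 1)
      ≤ Real.exp (k / 2 - l / 2 * t ^ 2) * (ε * C2 * (1 + t) ^ 3 *
          Real.exp (l / 4 + l / 4 * t ^ 2)) * (1 + t) ^ (d + 1) := by gcongr
    _ = Real.exp (k / 2 + l / 4) * C2 * ε *
          ((1 + t) ^ (d + 4) * Real.exp (-(l / 4 * t ^ 2))) := by
        have : Real.exp (k / 2 - l / 2 * t ^ 2) * Real.exp (l / 4 + l / 4 * t ^ 2) =
            Real.exp (k / 2 + l / 4) * Real.exp (-(l / 4 * t ^ 2)) := by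
          rw [← Real.exp_add, ← Real.exp_add]; ring_nf
        linear_combination (ε * C2 * (1 + t) ^ 3 * (1 + t) ^ (d + 1)) * this
    _ ≤ Real.exp (k / 2 + l / 4) * (C2 + 1) * ε * C5 := by
        gcongr
        · linarith
        · exact hC5b t ht0
    _ = _ := by ring

end LaplaceDifference

section Erosion

open scoped ENNReal

lemma gaussianReal_zero_one_le_volume : gaussianReal 0 1 ≤ volume := by
  rw [gaussianReal_of_var_ne_zero _ one_ne_zero]
  refine (withDensity_mono (g := 1) (Eventually.of_forall fun x => ?_)).trans_eq withDensity_one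
  change ENNReal.ofReal _ ≤ 1
  rw [ENNReal.ofReal_le_one, gaussianPDFReal_def]
  have h1 : (√(2 * Real.pi * (1 : NNReal)))⁻¹ ≤ 1 := by
    apply inv_le_one_of_one_le₀
    rw [Real.one_le_sqrt]
    have := Real.pi_gt_three
    simp only [NNReal.coe_one]
    linarith
  have h2 : Real.exp (-(x - 0) ^ 2 / (2 * (1 : NNReal))) ≤ 1 := by
    rw [Real.exp_le_one_iff]
    apply div_nonpos_of_nonpos_of_nonneg
    · nlinarith [sq_nonneg (x - 0)]
    · positivity
  exact mul_le_one₀ h1 (Real.exp_pos _).le h2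

variable {d : ℕ}

/-- The standard Gaussian measure on `Fin d → ℝ`. -/
noncomputable abbrev gaussianPi (d : ℕ) : Measure (Fin d → ℝ) :=
  Measure.pi fun _ => gaussianReal 0 1

lemma gaussianPi_absolutelyContinuous : gaussianPi d ≪ volume := by
  refine Measure.AbsolutelyContinuous.mk fun s hs h => ?_
  have hf : Measurable (s.indicator (1 : (Fin d → ℝ) → ℝ≥0∞)) := measurable_one.indicator hs
  have key : ∀ (J : Finset (Fin d)) (x : Fin d → ℝ),
      lmarginal (fun _ => gaussianReal 0 1) J (s.indicator 1) x ≤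
        lmarginal (fun _ => (volume : Measure ℝ)) J (s.indicator 1) x := by
    intro J
    induction J using Finset.induction_on with
    | empty => intro x; simp
    | insert a J ha ih =>
      intro x
      rw [lmarginal_insert _ hf ha, lmarginal_insert _ hf ha]
      exact lintegral_mono' gaussianReal_zero_one_le_volume fun t => ih _
  have := key Finset.univ 0
  rw [← lintegral_eq_lmarginal_univ, ← lintegral_eq_lmarginal_univ, lintegral_indicator_one hs,
    lintegral_indicator_one hs] at this
  exact le_antisymm (this.trans_eq h) zero_le

lemma volume_convex_diff_translate_le {I : Set ℝ} (hI : Convex ℝ I) {s : ℝ} (hs : 0 ≤ s) :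
    volume {t ∈ I | t + s ∉ I} ≤ ENNReal.ofReal s ∧
      volume {t ∈ I | t - s ∉ I} ≤ ENNReal.ofReal s := by
  have hord := hI.ordConnected
  constructor
  · refine (Real.volume_le_diam _).trans (Metric.ediam_le fun x hx y hy => ?_)
    rw [edist_dist, Real.dist_eq]
    refine ENNReal.ofReal_le_ofReal (abs_le.2 ⟨?_, ?_⟩)
    · by_contra h
      exact hx.2 (hord.out hx.1 hy.1 ⟨by linarith, by linarith⟩)
    · by_contra h
      exact hy.2 (hord.out hy.1 hx.1 ⟨by linarith, by linarith⟩)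
  · refine (Real.volume_le_diam _).trans (Metric.ediam_le fun x hx y hy => ?_)
    rw [edist_dist, Real.dist_eq]
    refine ENNReal.ofReal_le_ofReal (abs_le.2 ⟨?_, ?_⟩)
    · by_contra h
      exact hy.2 (hord.out hx.1 hy.1 ⟨by linarith, by linarith⟩)
    · by_contra h
      exact hx.2 (hord.out hy.1 hx.1 ⟨by linarith, by linarith⟩)

/-- The erosion of a set by a segment of half-length `s` in the direction of the `j`-th axis. -/
def axisErosion (j : Fin d) (s : ℝ) (C : Set (Fin d → ℝ)) : Set (Fin d → ℝ) :=
  (fun x => x + Pi.single j s) ⁻¹' C ∩ (fun x => x + Pi.single j (-s)) ⁻¹' C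

lemma convex_axisErosion {j : Fin d} {s : ℝ} {C : Set (Fin d → ℝ)} (hC : Convex ℝ C) :
    Convex ℝ (axisErosion j s C) :=
  (hC.translate_preimage_left _).inter (hC.translate_preimage_left _)

lemma measurableSet_axisErosion {j : Fin d} {s : ℝ} {C : Set (Fin d → ℝ)} (hC : MeasurableSet C) :
    MeasurableSet (axisErosion j s C) :=
  (measurable_add_const _ hC).inter (measurable_add_const _ hC)

lemma add_single_mem_of_mem_axisErosion {j : Fin d} {s : ℝ} {C : Set (Fin d → ℝ)}
    (hC : Convex ℝ C) {x : Fin d → ℝ} (hx : x ∈ axisErosion j s C) {t : ℝ} (ht : |t| ≤ s) :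
    x + Pi.single j t ∈ C := by
  have hconv : Convex ℝ {u : ℝ | x + Pi.single j u ∈ C} := by
    intro u hu v hv a b ha hb hab
    have h := hC hu hv ha hb hab
    change x + Pi.single j (a • u + b • v) ∈ C
    convert h using 1
    rw [smul_add, smul_add, add_add_add_comm, ← add_smul, hab, one_smul, Pi.single_add,
      Pi.single_smul, Pi.single_smul]
  exact hconv.ordConnected.out (x := -s) (y := s) hx.2 hx.1 (abs_le.1 ht)

lemma gaussianPi_axisErosion_ge {C : Set (Fin d → ℝ)} (hC : Convex ℝ C) (hCm : MeasurableSet C)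
    (j : Fin d) {s : ℝ} (hs : 0 ≤ s) :
    gaussianPi d C ≤ gaussianPi d (axisErosion j s C) + ENNReal.ofReal (2 * s) := by
  have hm := hCm.diff (measurableSet_axisErosion (j := j) (s := s) hCm)
  have hdiff : gaussianPi d (C \ axisErosion j s C) ≤ ENNReal.ofReal (2 * s) := by
    rw [← lintegral_indicator_one hm]
    have h2 : ∫⁻ _, ENNReal.ofReal (2 * s) ∂(gaussianPi d) = ENNReal.ofReal (2 * s) := by simp
    rw [← h2]
    refine lintegral_le_of_lmarginal_le {j} (measurable_one.indicator hm) measurable_const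
      fun x => ?_
    rw [lmarginal_singleton, lmarginal_singleton]
    simp only [lintegral_const, measure_univ, mul_one]
    set I : Set ℝ := {t | Function.update x j t ∈ C} with hI
    have hupd : ∀ t u : ℝ, Function.update x j t + Pi.single j u = Function.update x j (t + u) := by
      intro t u
      ext k
      rcases eq_or_ne k j with rfl | hk
      · simp
      · simp [hk]
    have hIc : Convex ℝ I := by
      intro t ht u hu a b ha hb hab
      have h := hC ht hu ha hb hab
      change Function.update x j (a • t + b • u) ∈ C
      convert h using 1
      ext k
      rcases eq_or_ne k j with rfl | hk
      · simp
      · simp [hk, ← add_mul, hab]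
    have hsub : (fun t => Function.update x j t) ⁻¹' (C \ axisErosion j s C) ⊆
        {t ∈ I | t + s ∉ I} ∪ {t ∈ I | t - s ∉ I} := by
      rintro t ⟨ht, hn⟩
      by_contra hcon
      have h1 : t + s ∈ I := by
        by_contra h; exact hcon (Or.inl ⟨ht, h⟩)
      have h2 : t - s ∈ I := by
        by_contra h; exact hcon (Or.inr ⟨ht, h⟩)
      refine hn ⟨?_, ?_⟩
      · change _ + _ ∈ C; rw [hupd]; exact h1
      · change _ + _ ∈ C; rw [hupd]; exact h2
    have h3 := volume_convex_diff_translate_le hIc hs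
    calc ∫⁻ t, (C \ axisErosion j s C).indicator 1 (Function.update x j t) ∂(gaussianReal 0 1)
        = gaussianReal 0 1 ((fun t => Function.update x j t) ⁻¹' (C \ axisErosion j s C)) := by
          rw [← lintegral_indicator_one (measurable_update x hm)]
          rfl
      _ ≤ volume ((fun t => Function.update x j t) ⁻¹' (C \ axisErosion j s C)) :=
          gaussianReal_zero_one_le_volume _
      _ ≤ volume {t ∈ I | t + s ∉ I} + volume {t ∈ I | t - s ∉ I} :=
          (measure_mono hsub).trans (measure_union_le _ _)
      _ ≤ ENNReal.ofReal s + ENNReal.ofReal s := add_le_add h3.1 h3.2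
      _ = ENNReal.ofReal (2 * s) := by rw [← ENNReal.ofReal_add hs hs, two_mul]
  calc gaussianPi d C ≤ gaussianPi d (axisErosion j s C ∪ C \ axisErosion j s C) :=
        measure_mono (by rw [Set.union_sdiff_self]; exact Set.subset_union_right)
    _ ≤ _ := (measure_union_le _ _).trans (by gcongr)

lemma gaussianPi_exists_erosion {C : Set (Fin d → ℝ)} (hC : Convex ℝ C) (hCm : MeasurableSet C)
    {s : ℝ} (hs : 0 ≤ s) :
    ∃ C' : Set (Fin d → ℝ), Convex ℝ C' ∧ MeasurableSet C' ∧
      (∀ x ∈ C', ∀ y : Fin d → ℝ, ‖y‖ ≤ s → x + y ∈ C) ∧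
      gaussianPi d C ≤ gaussianPi d C' + ENNReal.ofReal (2 * d * s) := by
  have key : ∀ J : Finset (Fin d), ∃ C' : Set (Fin d → ℝ), Convex ℝ C' ∧ MeasurableSet C' ∧
      (∀ x ∈ C', ∀ y : Fin d → ℝ, (∀ j, |y j| ≤ s) → (∀ j, j ∉ J → y j = 0) → x + y ∈ C) ∧
      gaussianPi d C ≤ gaussianPi d C' + ENNReal.ofReal (2 * J.card * s) := by
    intro J
    induction J using Finset.induction_on with
    | empty =>
      refine ⟨C, hC, hCm, fun x hx y _ hy => ?_, by simp⟩
      have : y = 0 := funext fun j => hy j (by simp)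
      simpa [this] using hx
    | insert a J ha ih =>
      obtain ⟨C', hc, hm, hsub, hle⟩ := ih
      refine ⟨axisErosion a s C', convex_axisErosion hc, measurableSet_axisErosion hm,
        fun x hx y hy hyJ => ?_, ?_⟩
      · have h1 := add_single_mem_of_mem_axisErosion hc hx (hy a)
        have h2 := hsub _ h1 (Function.update y a 0) (fun j => ?_) (fun j hj => ?_)
        · convert h2 using 1
          rw [add_assoc]
          congr 1
          ext k
          rcases eq_or_ne k a with rfl | hk
          · simp
          · simp [hk]
        · rcases eq_or_ne j a with rfl | hk
          · simpa using hs
          · simpa [hk] using hy j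
        · rcases eq_or_ne j a with rfl | hk
          · simp
          · simpa [hk] using hyJ j (by simp [hk, hj])
      · refine hle.trans ?_
        refine (add_le_add (gaussianPi_axisErosion_ge hc hm a hs) le_rfl).trans_eq ?_
        rw [add_assoc, ← ENNReal.ofReal_add (by positivity) (by positivity),
          Finset.card_insert_of_notMem ha]
        congr 2
        push_cast; ring
  obtain ⟨C', hc, hm, hsub, hle⟩ := key Finset.univ
  refine ⟨C', hc, hm, fun x hx y hy => hsub x hx y (fun j => (norm_le_pi_norm y j).trans hy)
    (by simp), ?_⟩
  simpa using hle

open scoped MatrixOrder in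
lemma exists_multivariateGaussian_equiv {K : Matrix (Fin d) (Fin d) ℝ} (hK : K.PosDef) :
    ∃ T : (Fin d → ℝ) ≃L[ℝ] EuclideanSpace ℝ (Fin d),
      multivariateGaussian 0 K = (gaussianPi d).map T := by
  set L := Matrix.toEuclideanCLM (𝕜 := ℝ) (CFC.sqrt K) with hL
  set T0 : (Fin d → ℝ) →ₗ[ℝ] EuclideanSpace ℝ (Fin d) :=
    (L : EuclideanSpace ℝ (Fin d) →ₗ[ℝ] EuclideanSpace ℝ (Fin d)) ∘ₗ
      (WithLp.linearEquiv 2 ℝ (Fin d → ℝ)).symm.toLinearMap with hT0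
  have hT0x : ∀ x, T0 x = L (WithLp.toLp 2 x) := fun x => rfl
  have hinj : Function.Injective T0 := by
    rw [← LinearMap.ker_eq_bot, LinearMap.ker_eq_bot']
    intro x hx
    rw [hT0x] at hx
    have h1 : (CFC.sqrt K).mulVec x = 0 := by
      have := congrArg WithLp.ofLp hx
      rwa [hL, Matrix.ofLp_toEuclideanCLM] at this
    have h2 : K.mulVec x = 0 := by
      rw [← CFC.sqrt_mul_sqrt_self K hK.posSemidef.nonneg, ← Matrix.mulVec_mulVec, h1,
        Matrix.mulVec_zero]
    by_contra hne
    have h3 := hK.dotProduct_mulVec_pos hne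
    rw [h2, dotProduct_zero] at h3
    exact lt_irrefl _ h3
  refine ⟨(T0.linearEquivOfInjective hinj (by simp)).toContinuousLinearEquiv, ?_⟩
  rw [multivariateGaussian, ← map_pi_eq_stdGaussian, Measure.map_map (by fun_prop) (by fun_prop)]
  congr 1
  ext1 x
  simp only [Function.comp, zero_add]
  exact (hT0x x).symm

/-- A Gaussian measure with nondegenerate covariance charges uniformly little the inner boundary
layers of convex sets. -/
theorem multivariateGaussian_exists_erosion {K : Matrix (Fin d) (Fin d) ℝ} (hK : K.PosDef) :
    ∃ c : ℝ, 0 ≤ c ∧ ∀ C : Set (EuclideanSpace ℝ (Fin d)), Convex ℝ C → MeasurableSet C →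
      ∀ s : ℝ, 0 ≤ s → ∃ C' : Set (EuclideanSpace ℝ (Fin d)), Convex ℝ C' ∧ MeasurableSet C' ∧
        (∀ x ∈ C', ∀ y : EuclideanSpace ℝ (Fin d), ‖y‖ ≤ s → x + y ∈ C) ∧
        (multivariateGaussian 0 K).real C ≤ (multivariateGaussian 0 K).real C' + c * s := by
  obtain ⟨T, hT⟩ := exists_multivariateGaussian_equiv hK
  set b := ‖(T.symm : EuclideanSpace ℝ (Fin d) →L[ℝ] (Fin d → ℝ))‖ with hb
  refine ⟨2 * d * b, by positivity, fun C hC hCm s hs => ?_⟩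
  have hTm : Measurable T := T.continuous.measurable
  obtain ⟨C', hc, hm, hsub, hle⟩ := gaussianPi_exists_erosion (hC.linear_preimage
    (T : (Fin d → ℝ) →ₗ[ℝ] EuclideanSpace ℝ (Fin d))) (hTm hCm) (s := b * s) (by positivity)
  refine ⟨T.symm ⁻¹' C', hc.linear_preimage
    (T.symm : EuclideanSpace ℝ (Fin d) →ₗ[ℝ] (Fin d → ℝ)), T.symm.continuous.measurable hm,
    fun x hx y hy => ?_, ?_⟩
  · have h1 := hsub _ hx (T.symm y) (((T.symm :
      EuclideanSpace ℝ (Fin d) →L[ℝ] (Fin d → ℝ)).le_opNorm y).trans (by gcongr))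
    have h2 : T (T.symm x + T.symm y) ∈ C := h1
    simpa using h2
  · have hpre : T ⁻¹' (T.symm ⁻¹' C') = C' := by ext x; simp
    rw [hT, map_measureReal_apply hTm hCm,
      map_measureReal_apply hTm (T.symm.continuous.measurable hm), hpre]
    have h1 := ENNReal.toReal_mono (by finiteness) hle
    rw [ENNReal.toReal_add (by finiteness) (by finiteness),
      ENNReal.toReal_ofReal (by positivity)] at h1
    refine h1.trans_eq ?_
    simp only [Measure.real]
    ring

lemma multivariateGaussian_closure {K : Matrix (Fin d) (Fin d) ℝ} (hK : K.PosDef)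
    {C : Set (EuclideanSpace ℝ (Fin d))} (hC : Convex ℝ C) :
    (multivariateGaussian 0 K).real (closure C) ≤ (multivariateGaussian 0 K).real C := by
  obtain ⟨T, hT⟩ := exists_multivariateGaussian_equiv hK
  have h0 : multivariateGaussian 0 K (frontier C) = 0 := by
    rw [hT, Measure.map_apply T.continuous.measurable isClosed_frontier.measurableSet]
    have h1 : T ⁻¹' frontier C = frontier (T ⁻¹' C) := T.toHomeomorph.preimage_frontier C
    rw [h1]
    exact gaussianPi_absolutelyContinuous ((hC.linear_preimage
      (T : (Fin d → ℝ) →ₗ[ℝ] EuclideanSpace ℝ (Fin d))).addHaar_frontier volume)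
  have h1 : closure C ⊆ C ∪ frontier C := by
    rw [closure_eq_self_union_frontier]
  refine (measureReal_mono h1).trans ((measureReal_union_le _ _).trans ?_)
  simp [Measure.real, h0]

lemma mem_closure_of_forall_add_mem_thickening {E : Type*} [NormedAddCommGroup E]
    [InnerProductSpace ℝ E] [CompleteSpace E] {C : Set E} (hC : Convex ℝ C) {s : ℝ} (hs : 0 ≤ s)
    {x : E} (hx : ∀ y : E, ‖y‖ ≤ s → x + y ∈ Metric.thickening s C) : x ∈ closure C := by
  by_contra hn
  obtain ⟨f, u, hfC, hfx⟩ := geometric_hahn_banach_closed_point hC.closure isClosed_closure hn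
  set w := (InnerProductSpace.toDual ℝ E).symm f with hw
  have hfw : ∀ y, f y = inner ℝ w y := fun y => (InnerProductSpace.toDual_symm_apply).symm
  have hy : ‖(s / ‖w‖) • w‖ ≤ s := by
    rw [norm_smul, norm_div, norm_norm, Real.norm_of_nonneg hs]
    rcases eq_or_ne ‖w‖ 0 with h | h
    · simpa [h] using hs
    · rw [div_mul_cancel₀ _ h]
  obtain ⟨c, hc, hd⟩ := Metric.mem_thickening_iff.1 (hx _ hy)
  have h1 := hfC c (subset_closure hc)
  set v := x + (s / ‖w‖) • w - c with hv
  rw [dist_eq_norm] at hd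
  have h2 : f v ≤ ‖w‖ * s := by
    rw [hfw]
    exact (real_inner_le_norm _ _).trans (by gcongr)
  have h3 : f v = f x + ‖w‖ * s - f c := by
    rw [hv, map_sub, map_add, map_smul, hfw w, real_inner_self_eq_norm_sq, smul_eq_mul]
    rcases eq_or_ne ‖w‖ 0 with h | h
    · simp [h]
    · field_simp
  linarith

/-- A Gaussian measure with nondegenerate covariance charges uniformly little the outer boundary
layers of convex sets. -/
theorem multivariateGaussian_exists_dilation {K : Matrix (Fin d) (Fin d) ℝ} (hK : K.PosDef) :
    ∃ c : ℝ, 0 ≤ c ∧ ∀ C : Set (EuclideanSpace ℝ (Fin d)), Convex ℝ C → MeasurableSet C →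
      ∀ s : ℝ, 0 < s → ∃ C' : Set (EuclideanSpace ℝ (Fin d)), Convex ℝ C' ∧ MeasurableSet C' ∧
        (∀ x ∈ C, ∀ y : EuclideanSpace ℝ (Fin d), ‖y‖ ≤ s → x + y ∈ C') ∧
        (multivariateGaussian 0 K).real C' ≤ (multivariateGaussian 0 K).real C + c * s := by
  obtain ⟨c, hc0, hc⟩ := multivariateGaussian_exists_erosion hK
  refine ⟨2 * c, by positivity, fun C hC hCm s hs => ?_⟩
  refine ⟨Metric.thickening (2 * s) C, hC.thickening _, Metric.isOpen_thickening.measurableSet,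
    fun x hx y hy => Metric.mem_thickening_iff.2 ⟨x, hx, ?_⟩, ?_⟩
  · rw [dist_eq_norm, add_sub_cancel_left]; linarith
  · obtain ⟨C', -, -, hsub, hle⟩ := hc _ (hC.thickening (2 * s))
      Metric.isOpen_thickening.measurableSet (2 * s) (by positivity)
    have h1 : C' ⊆ closure C := fun x hx =>
      mem_closure_of_forall_add_mem_thickening hC (by positivity) (hsub x hx)
    have h2 := (measureReal_mono (μ := multivariateGaussian 0 K) h1).trans
      (multivariateGaussian_closure hK hC)
    linarith

end Erosion

section Kernel

open FourierTransform SchwartzMap Convolution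

variable {E : Type*} [NormedAddCommGroup E] [InnerProductSpace ℝ E] [FiniteDimensional ℝ E]
  [MeasurableSpace E] [BorelSpace E]

lemma conj_fourier_of_even_real {f : E → ℂ} (hreal : ∀ x, (starRingEnd ℂ) (f x) = f x)
    (heven : ∀ x, f (-x) = f x) (w : E) : (starRingEnd ℂ) (𝓕 f w) = 𝓕 f w := by
  rw [Real.fourier_eq', ← integral_conj, ← integral_neg_eq_self]
  refine integral_congr_ae (Eventually.of_forall fun x => ?_)
  simp only [smul_eq_mul, map_mul, hreal, heven, inner_neg_left, ← Complex.exp_conj]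
  congr 2
  simp [Complex.conj_ofReal, Complex.conj_ofNat]

/-- There is a nonnegative integrable kernel with finite first moment and positive mass whose
Fourier transform is continuous and supported in a given ball. -/
theorem exists_bandlimited_kernel {ρ : ℝ} (hρ : 0 < ρ) :
    ∃ (k : E → ℝ) (χ : E → ℂ), Continuous k ∧ (∀ v, 0 ≤ k v) ∧ Integrable k ∧
      Integrable (fun v => ‖v‖ * k v) ∧ 0 < ∫ v, k v ∧ Continuous χ ∧ Integrable χ ∧
      (∃ M, ∀ s, ‖χ s‖ ≤ M) ∧ (∀ s, ρ < ‖s‖ → χ s = 0) ∧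
      ∀ v, (k v : ℂ) = ∫ s, χ s * Complex.exp (Complex.I * (inner ℝ s v : ℝ)) := by
  let ψ : ContDiffBump (0 : E) := ⟨ρ / 4, ρ / 2, by positivity, by linarith⟩
  have hcs : HasCompactSupport (fun x => (ψ x : ℂ)) :=
    ψ.hasCompactSupport.comp_left (g := fun r : ℝ => (r : ℂ)) Complex.ofReal_zero
  let f : 𝓢(E, ℂ) := hcs.toSchwartzMap (Complex.ofRealCLM.contDiff.comp ψ.contDiff)
  have hf : ∀ x, f x = (ψ x : ℂ) := fun x => rfl
  let F : 𝓢(E, ℂ) := 𝓕 f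
  let χ : 𝓢(E, ℂ) := SchwartzMap.convolution (ContinuousLinearMap.mul ℂ ℂ) f f
  set c : ℝ := -(2 * Real.pi)⁻¹ with hc
  have hc0 : c ≠ 0 := neg_ne_zero.2 (inv_ne_zero (by positivity))
  have hconj : ∀ w, (starRingEnd ℂ) (F w) = F w := fun w =>
    conj_fourier_of_even_real (f := f) (fun x => by rw [hf, Complex.conj_ofReal])
      (fun x => by rw [hf, hf, ψ.neg]) w
  have hFsq : ∀ w, ((‖F w‖ ^ 2 : ℝ) : ℂ) = 𝓕 χ w := by
    intro w
    rw [SchwartzMap.fourier_convolution_apply, Real.fourier_mul_convolution_eq f.integrable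
      f.integrable]
    have := Complex.mul_conj' (F w)
    rw [hconj] at this
    push_cast
    exact this.symm
  obtain ⟨M, hM⟩ : ∃ M, ∀ w, ‖F w‖ ≤ M := by
    obtain ⟨C, -, hC⟩ := F.decay 0 0
    exact ⟨C, fun w => by simpa using hC w⟩
  have hpow : ∀ n : ℕ, Integrable (fun w => ‖w‖ ^ n * ‖F w‖ ^ 2) := by
    intro n
    refine ((F.integrable_pow_mul volume n).mul_const M).mono' (by fun_prop)
      (Eventually.of_forall fun w => ?_)
    rw [Real.norm_of_nonneg (by positivity), sq, ← mul_assoc]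
    exact mul_le_mul_of_nonneg_left (hM w) (by positivity)
  have hk : Integrable (fun v : E => ‖F (c • v)‖ ^ 2) := by
    have := (hpow 0).comp_smul hc0
    simpa using this
  refine ⟨fun v => ‖F (c • v)‖ ^ 2, χ, by fun_prop, fun v => by positivity, hk, ?_, ?_,
    χ.continuous, χ.integrable, ?_, fun s hs => ?_, fun v => ?_⟩
  · have := ((hpow 1).comp_smul hc0).const_mul |c|⁻¹
    refine this.congr (Eventually.of_forall fun v => ?_)
    simp only [pow_one, norm_smul, Real.norm_eq_abs]
    have : |c| ≠ 0 := abs_ne_zero.2 hc0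
    field_simp
  · refine (integral_pos_iff_support_of_nonneg (fun v => by positivity) hk).2 ?_
    have hcont : Continuous (fun v : E => ‖F (c • v)‖ ^ 2) := by fun_prop
    refine hcont.isOpen_support.measure_pos volume ⟨0, ?_⟩
    have hF0 : F 0 = ((∫ x, ψ x : ℝ) : ℂ) := by
      change 𝓕 (f : E → ℂ) 0 = _
      rw [Real.fourier_eq', ← integral_complex_ofReal]
      refine integral_congr_ae (Eventually.of_forall fun x => ?_)
      simp [hf]
    have : F 0 ≠ 0 := by
      rw [hF0, Complex.ofReal_ne_zero]
      exact ψ.integral_pos.ne'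
    simpa using this
  · obtain ⟨C, -, hC⟩ := χ.decay 0 0
    exact ⟨C, fun w => by simpa using hC w⟩
  · rw [SchwartzMap.convolution_apply, MeasureTheory.convolution]
    refine integral_eq_zero_of_ae (Eventually.of_forall fun t => ?_)
    simp only [ContinuousLinearMap.mul_apply', hf, Pi.zero_apply, mul_eq_zero,
      Complex.ofReal_eq_zero]
    by_contra! hcon
    have h1 : ‖t‖ < ρ / 2 := by
      by_contra! h
      exact hcon.1 (ψ.zero_of_le_dist (by simpa using h))
    have h2 : ‖s - t‖ < ρ / 2 := by
      by_contra! h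
      exact hcon.2 (ψ.zero_of_le_dist (by simpa using h))
    have h3 : ‖s‖ ≤ ‖s - t‖ + ‖t‖ := by simpa using norm_add_le (s - t) t
    linarith
  · rw [hFsq]
    change 𝓕 (χ : E → ℂ) _ = _
    rw [Real.fourier_eq']
    refine integral_congr_ae (Eventually.of_forall fun s => ?_)
    simp only [smul_eq_mul, inner_smul_right, hc]
    rw [mul_comm]
    congr 2
    push_cast
    have : (Real.pi : ℂ) ≠ 0 := by exact_mod_cast Real.pi_ne_zero
    field_simp

end Kernel

section Smoothing

variable {E : Type*} [NormedAddCommGroup E] [InnerProductSpace ℝ E] [MeasurableSpace E]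

/-- The Fourier transform of the measure with density `w` with respect to `μ`. -/
noncomputable def weightedCharFun (w : E → ℝ) (μ : Measure E) (η : E) : ℂ :=
  ∫ x, (w x : ℂ) * Complex.exp (Complex.I * (inner ℝ η x : ℝ)) ∂μ

lemma norm_weightedCharFun_le {μ : Measure E} (w : E → ℝ) (hw0 : ∀ x, 0 ≤ w x) (η : E) :
    ‖weightedCharFun w μ η‖ ≤ ∫ x, w x ∂μ := by
  refine (norm_integral_le_integral_norm _).trans_eq ?_
  refine integral_congr_ae (Eventually.of_forall fun x => ?_)
  simp only []
  rw [norm_mul, mul_comm Complex.I, Complex.norm_exp_ofReal_mul_I, Complex.norm_real, mul_one,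
    Real.norm_of_nonneg (hw0 x)]

variable [BorelSpace E] {w : E → ℝ} {k : E → ℝ} {χ : E → ℂ}

lemma continuous_weightedCharFun [SecondCountableTopology E] {μ : Measure E} (hw : Integrable w μ) :
    Continuous (weightedCharFun w μ) := by
  unfold weightedCharFun
  refine continuous_of_dominated (bound := fun x => ‖w x‖) (fun η => ?_) (fun η => ?_) hw.norm
    (Eventually.of_forall fun x => by fun_prop)
  · exact hw.ofReal.aestronglyMeasurable.mul
      (Continuous.aestronglyMeasurable (by fun_prop))
  · refine Eventually.of_forall fun x => ?_
    rw [norm_mul, mul_comm Complex.I, Complex.norm_exp_ofReal_mul_I, Complex.norm_real, mul_one]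

variable [FiniteDimensional ℝ E]

lemma integral_weight_mul_kernel_eq {μ : Measure E} [IsFiniteMeasure μ] (hw : Integrable w μ)
    (hχ : Integrable χ)
    (hk : ∀ v, (k v : ℂ) = ∫ s, χ s * Complex.exp (Complex.I * (inner ℝ s v : ℝ)))
    (e : ℝ) (u : E) :
    ((∫ x, w x * k (e • (u - x)) ∂μ : ℝ) : ℂ) =
      ∫ s, χ s * Complex.exp (Complex.I * (inner ℝ s (e • u) : ℝ)) *
        weightedCharFun w μ (-(e • s)) := by
  have hint : Integrable (Function.uncurry fun x s => (w x : ℂ) * (χ s *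
      Complex.exp (Complex.I * (inner ℝ s (e • (u - x)) : ℝ)))) (μ.prod volume) := by
    have h1 : Integrable (fun z : E × E => (w z.1 : ℂ) * χ z.2) (μ.prod volume) :=
      hw.ofReal.mul_prod hχ
    have h2 : Continuous (fun z : E × E =>
        Complex.exp (Complex.I * (inner ℝ z.2 (e • (u - z.1)) : ℝ))) := by fun_prop
    refine (h1.mul_bdd (c := 1) h2.aestronglyMeasurable (Eventually.of_forall fun z => ?_)).congr
      (Eventually.of_forall fun z => ?_)
    · rw [mul_comm, Complex.norm_exp_ofReal_mul_I]
    · simp only [Function.uncurry, mul_assoc]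
  rw [← integral_complex_ofReal]
  simp only [Complex.ofReal_mul, hk]
  simp only [← integral_const_mul]
  rw [integral_integral_swap hint]
  refine integral_congr_ae (Eventually.of_forall fun s => ?_)
  simp only [weightedCharFun]
  rw [← integral_const_mul]
  refine integral_congr_ae (Eventually.of_forall fun x => ?_)
  have : Complex.exp (Complex.I * (inner ℝ s (e • (u - x)) : ℝ)) =
      Complex.exp (Complex.I * (inner ℝ s (e • u) : ℝ)) *
        Complex.exp (Complex.I * (inner ℝ (-(e • s)) x : ℝ)) := by
    rw [← Complex.exp_add, ← mul_add]
    congr 2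
    rw [smul_sub, inner_sub_right, inner_neg_left, real_inner_smul_left, real_inner_smul_right _ x]
    push_cast; ring
  simp only [this]
  ring

lemma abs_integral_weight_mul_kernel_sub_le {μ ν : Measure E} [IsFiniteMeasure μ]
    [IsFiniteMeasure ν] (hμ : Integrable w μ) (hν : Integrable w ν) (hw0 : ∀ x, 0 ≤ w x)
    (hχ : Integrable χ)
    (hk : ∀ v, (k v : ℂ) = ∫ s, χ s * Complex.exp (Complex.I * (inner ℝ s v : ℝ)))
    {M ρ : ℝ} (hχM : ∀ s, ‖χ s‖ ≤ M) (hχρ : ∀ s, ρ < ‖s‖ → χ s = 0)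
    {h : E → ℝ} (hh : Integrable h) (hh0 : ∀ η, 0 ≤ h η) {a ε : ℝ} (ha : 0 ≤ a) (hε : 0 < ε)
    (hdiff : ∀ η, ε * ‖η‖ ≤ ρ → ‖weightedCharFun w μ η - weightedCharFun w ν η‖ ≤ a * h η)
    (u : E) :
    |(∫ x, w x * k (ε⁻¹ • (u - x)) ∂μ) - ∫ x, w x * k (ε⁻¹ • (u - x)) ∂ν| ≤
      ε ^ Module.finrank ℝ E * (M * a * ∫ η, h η) := by
  have hM0 : 0 ≤ M := (norm_nonneg _).trans (hχM 0)
  have hI : ∀ τ : Measure E, Integrable w τ → Integrable (fun s => χ s *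
      Complex.exp (Complex.I * (inner ℝ s (ε⁻¹ • u) : ℝ)) *
        weightedCharFun w τ (-(ε⁻¹ • s))) := by
    intro τ hτ
    refine Integrable.mul_bdd (c := ∫ x, w x ∂τ) (Integrable.mul_bdd (c := 1) hχ
      (Continuous.aestronglyMeasurable (by fun_prop)) (Eventually.of_forall fun s => ?_)) ?_
      (Eventually.of_forall fun s => norm_weightedCharFun_le w hw0 _)
    · rw [mul_comm, Complex.norm_exp_ofReal_mul_I]
    · exact ((continuous_weightedCharFun hτ).comp (by fun_prop)).aestronglyMeasurable
  rw [← Real.norm_eq_abs, ← Complex.norm_real, Complex.ofReal_sub,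
    integral_weight_mul_kernel_eq hμ hχ hk, integral_weight_mul_kernel_eq hν hχ hk,
    ← integral_sub (hI μ hμ) (hI ν hν)]
  have hhs : Integrable (fun s => h (-ε⁻¹ • s)) :=
    hh.comp_smul (neg_ne_zero.2 (inv_ne_zero hε.ne'))
  refine (norm_integral_le_of_norm_le (hhs.const_mul (M * a))
    (Eventually.of_forall fun s => ?_)).trans_eq ?_
  · rw [← mul_sub, norm_mul, norm_mul, mul_comm Complex.I, Complex.norm_exp_ofReal_mul_I, mul_one]
    rcases le_or_gt ‖s‖ ρ with hs | hs
    · have h1 := hdiff (-(ε⁻¹ • s)) (by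
        rw [norm_neg, norm_smul, norm_inv, Real.norm_of_nonneg hε.le,
          mul_inv_cancel_left₀ hε.ne']
        exact hs)
      rw [neg_smul, mul_assoc]
      exact mul_le_mul (hχM s) h1 (norm_nonneg _) hM0
    · rw [hχρ s hs, norm_zero, zero_mul]
      exact mul_nonneg (mul_nonneg hM0 ha) (hh0 _)
  · rw [integral_const_mul, Measure.integral_comp_smul, smul_eq_mul]
    have : |((-ε⁻¹) ^ Module.finrank ℝ E)⁻¹| = ε ^ Module.finrank ℝ E := by
      rw [abs_inv, abs_pow, abs_neg, abs_inv, abs_of_pos hε, inv_pow, inv_inv]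
    rw [this]; ring

lemma integrable_kernel_mul_shift {μ : Measure E} [IsFiniteMeasure μ] (hμ : Integrable w μ)
    (hki : Integrable k) {g : E → ℝ} (hg : Measurable g) (hg1 : ∀ x, |g x| ≤ 1) (ε : ℝ) :
    Integrable (Function.uncurry fun y x => k y * (g (x + ε • y) * w x)) (volume.prod μ) := by
  have h1 : Integrable (fun z : E × E => k z.1 * w z.2) (volume.prod μ) := hki.mul_prod hμ
  refine (h1.mul_bdd (c := 1) (f := fun z : E × E => k z.1 * w z.2)
    (g := fun z : E × E => g (z.2 + ε • z.1)) ?_ (Eventually.of_forall fun z => hg1 _)).congr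
    (Eventually.of_forall fun z => ?_)
  · exact (hg.comp (by fun_prop)).aestronglyMeasurable
  · simp only [Function.uncurry]; ring

lemma integral_kernel_mul_shift_eq {μ : Measure E} [IsFiniteMeasure μ] (hμ : Integrable w μ)
    (hki : Integrable k) (hkc : Continuous k) {Mk : ℝ} (hkM : ∀ v, |k v| ≤ Mk) {g : E → ℝ}
    (hg : Measurable g) (hg1 : ∀ x, |g x| ≤ 1) (hgi : Integrable g) {ε : ℝ} (hε : 0 < ε) :
    ∫ y, k y * ∫ x, g (x + ε • y) * w x ∂μ =
      (ε ^ Module.finrank ℝ E)⁻¹ * ∫ u, g u * ∫ x, w x * k (ε⁻¹ • (u - x)) ∂μ := by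
  have h1 : ∀ x, ∫ y, k y * (g (x + ε • y) * w x) =
      (ε ^ Module.finrank ℝ E)⁻¹ * ∫ u, g u * (w x * k (ε⁻¹ • (u - x))) := by
    intro x
    have h2 := Measure.integral_comp_smul (μ := (volume : Measure E))
      (fun v => k (ε⁻¹ • v) * (g (x + v) * w x)) ε
    simp only [inv_smul_smul₀ hε.ne'] at h2
    rw [h2, smul_eq_mul, abs_of_nonneg (by positivity),
      ← integral_sub_right_eq_self (fun v => k (ε⁻¹ • v) * (g (x + v) * w x)) x]
    congr 1
    refine integral_congr_ae (Eventually.of_forall fun u => ?_)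
    simp only [add_sub_cancel]
    ring
  simp only [← integral_const_mul]
  rw [integral_integral_swap (integrable_kernel_mul_shift hμ hki hg hg1 ε)]
  simp only [h1]
  rw [integral_const_mul, integral_integral_swap]
  · rw [← integral_const_mul]
    simp only [integral_const_mul]
  · have h3 : Integrable (fun z : E × E => w z.1 * g z.2) (μ.prod volume) := hμ.mul_prod hgi
    refine (h3.mul_bdd (c := Mk) (f := fun z : E × E => w z.1 * g z.2)
      (g := fun z : E × E => k (ε⁻¹ • (z.2 - z.1))) ?_
      (Eventually.of_forall fun z => hkM _)).congr (Eventually.of_forall fun z => ?_)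
    · exact (hkc.comp (by fun_prop)).aestronglyMeasurable
    · simp only [Function.uncurry]; ring

/-- Averages over the kernel of shifted integrals against the weighted difference of two measures
are controlled by the difference of the weighted characteristic functions at low frequencies. -/
theorem abs_integral_kernel_mul_shift_sub_le {μ ν : Measure E} [IsFiniteMeasure μ]
    [IsFiniteMeasure ν] (hμ : Integrable w μ) (hν : Integrable w ν) (hw0 : ∀ x, 0 ≤ w x)
    (hki : Integrable k) (hkc : Continuous k) (hχ : Integrable χ)
    (hk : ∀ v, (k v : ℂ) = ∫ s, χ s * Complex.exp (Complex.I * (inner ℝ s v : ℝ)))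
    {M ρ : ℝ} (hχM : ∀ s, ‖χ s‖ ≤ M) (hχρ : ∀ s, ρ < ‖s‖ → χ s = 0)
    {h : E → ℝ} (hh : Integrable h) (hh0 : ∀ η, 0 ≤ h η) {a ε : ℝ} (ha : 0 ≤ a) (hε : 0 < ε)
    (hdiff : ∀ η, ε * ‖η‖ ≤ ρ → ‖weightedCharFun w μ η - weightedCharFun w ν η‖ ≤ a * h η)
    {g : E → ℝ} (hg : Measurable g) (hg0 : ∀ x, 0 ≤ g x) (hg1 : ∀ x, g x ≤ 1)
    (hgi : Integrable g) :
    Integrable (fun y => k y * ((∫ x, g (x + ε • y) * w x ∂μ) - ∫ x, g (x + ε • y) * w x ∂ν)) ∧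
    |∫ y, k y * ((∫ x, g (x + ε • y) * w x ∂μ) - ∫ x, g (x + ε • y) * w x ∂ν)| ≤
      M * a * (∫ η, h η) * ∫ u, g u := by
  have hg1' : ∀ x, |g x| ≤ 1 := fun x => by rw [abs_of_nonneg (hg0 x)]; exact hg1 x
  have hkM : ∀ v, |k v| ≤ ∫ s, ‖χ s‖ := by
    intro v
    rw [← Real.norm_eq_abs, ← Complex.norm_real, hk]
    refine (norm_integral_le_integral_norm _).trans_eq ?_
    refine integral_congr_ae (Eventually.of_forall fun s => ?_)
    simp only []
    rw [norm_mul, mul_comm Complex.I, Complex.norm_exp_ofReal_mul_I, mul_one]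
  have hI : ∀ τ : Measure E, [IsFiniteMeasure τ] → Integrable w τ →
      Integrable (fun y => k y * ∫ x, g (x + ε • y) * w x ∂τ) := by
    intro τ _ hτ
    refine (integrable_kernel_mul_shift hτ hki hg hg1' ε).integral_prod_left.congr
      (Eventually.of_forall fun y => ?_)
    simp only [Function.uncurry, integral_const_mul]
  have hJ : ∀ τ : Measure E, [IsFiniteMeasure τ] → Integrable w τ →
      Integrable (fun u => g u * ∫ x, w x * k (ε⁻¹ • (u - x)) ∂τ) := by
    intro τ _ hτ
    have h3 : Integrable (fun z : E × E => g z.1 * w z.2) (volume.prod τ) := hgi.mul_prod hτ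
    have h4 := (h3.mul_bdd (c := ∫ s, ‖χ s‖) (f := fun z : E × E => g z.1 * w z.2)
      (g := fun z : E × E => k (ε⁻¹ • (z.1 - z.2)))
      (hkc.comp (by fun_prop)).aestronglyMeasurable (Eventually.of_forall fun z => hkM _))
    refine h4.integral_prod_left.congr (Eventually.of_forall fun u => ?_)
    simp only [mul_assoc, integral_const_mul]
  simp only [mul_sub]
  refine ⟨(hI μ hμ).sub (hI ν hν), ?_⟩
  rw [integral_sub (hI μ hμ) (hI ν hν), integral_kernel_mul_shift_eq hμ hki hkc hkM hg hg1' hgi hε,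
    integral_kernel_mul_shift_eq hν hki hkc hkM hg hg1' hgi hε, ← mul_sub,
    ← integral_sub (hJ μ hμ) (hJ ν hν), abs_mul, abs_of_pos (by positivity)]
  rw [inv_mul_le_iff₀ (by positivity), ← integral_const_mul, ← integral_const_mul]
  rw [← Real.norm_eq_abs]
  refine norm_integral_le_of_norm_le ((hgi.const_mul _).const_mul _)
    (Eventually.of_forall fun u => ?_)
  rw [← mul_sub, Real.norm_eq_abs, abs_mul, abs_of_nonneg (hg0 u), mul_comm]
  calc _ ≤ (ε ^ Module.finrank ℝ E * (M * a * ∫ η, h η)) * g u :=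
        mul_le_mul_of_nonneg_right (abs_integral_weight_mul_kernel_sub_le hμ hν hw0 hχ hk hχM hχρ
          hh hh0 ha hε hdiff u) (hg0 u)
    _ = _ := by ring

end Smoothing

section ShiftedWeight

variable {E : Type*} [NormedAddCommGroup E] [MeasurableSpace E] [BorelSpace E]

lemma le_of_forall_kernel_average [InnerProductSpace ℝ E] [FiniteDimensional ℝ E] {k G : E → ℝ} (hk0 : ∀ v, 0 ≤ k v)
    (hki : Integrable k)
    (hk1 : Integrable (fun v => ‖v‖ * k v)) (hm : 0 < ∫ v, k v) {R : ℝ} (hR : 0 < R)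
    (hmR : (∫ v, ‖v‖ * k v) / R ≤ (∫ v, k v) / 4) {Δ T c₃ c₄ J : ℝ} (hT1 : -Δ ≤ T) (hT2 : T ≤ Δ)
    (hc₃ : 0 ≤ c₃) (hc₄ : 0 ≤ c₄) (hG : ∀ y, -(Δ + c₃ * ‖y‖) ≤ G y)
    (hGR : ∀ y, ‖y‖ ≤ R → T - c₄ ≤ G y) (hGi : Integrable (fun y => k y * G y))
    (hJ : ∫ y, k y * G y ≤ J) :
    T ≤ Δ / 2 + (J / (∫ v, k v) + c₄ + c₃ * (∫ v, ‖v‖ * k v) / (∫ v, k v)) := by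
  set m0 := ∫ v, k v with hm0
  set m1 := ∫ v, ‖v‖ * k v with hm1
  have hlow : ∀ y, k y * (T - c₄) - ((T + Δ) / R + c₃) * (‖y‖ * k y) ≤ k y * G y := by
    intro y
    have h1 : T - c₄ - ((T + Δ) / R + c₃) * ‖y‖ ≤ G y := by
      rcases le_or_gt ‖y‖ R with hy | hy
      · refine le_trans ?_ (hGR y hy)
        have : 0 ≤ ((T + Δ) / R + c₃) * ‖y‖ := by
          have : 0 ≤ T + Δ := by linarith
          positivity
        linarith
      · refine le_trans ?_ (hG y)
        have h2 : T + Δ ≤ (T + Δ) / R * ‖y‖ := by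
          rw [div_mul_eq_mul_div, le_div_iff₀ hR]
          exact mul_le_mul_of_nonneg_left hy.le (by linarith)
        rw [add_mul]; linarith
    calc _ = k y * (T - c₄ - ((T + Δ) / R + c₃) * ‖y‖) := by ring
      _ ≤ _ := mul_le_mul_of_nonneg_left h1 (hk0 y)
  have h1 := integral_mono ((hki.mul_const _).sub (hk1.const_mul _)) hGi hlow
  have h2 : ∫ y, (k y * (T - c₄) - ((T + Δ) / R + c₃) * (‖y‖ * k y)) =
      m0 * (T - c₄) - ((T + Δ) / R + c₃) * m1 := by
    rw [integral_sub (hki.mul_const _) (hk1.const_mul _), integral_mul_const, integral_const_mul]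
  have h3 : m0 * (T - c₄) - ((T + Δ) / R + c₃) * m1 ≤ J := by
    rw [← h2]; exact h1.trans hJ
  have h4 : (T + Δ) / R * m1 ≤ m0 * Δ / 2 := by
    calc (T + Δ) / R * m1 = (T + Δ) * (m1 / R) := by ring
      _ ≤ (T + Δ) * (m0 / 4) := mul_le_mul_of_nonneg_left hmR (by linarith)
      _ ≤ (2 * Δ) * (m0 / 4) := mul_le_mul_of_nonneg_right (by linarith) (by positivity)
      _ = _ := by ring
  have h5 : m0 * T ≤ m0 * (Δ / 2 + (J / m0 + c₄ + c₃ * m1 / m0)) := by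
    have : m0 * (Δ / 2 + (J / m0 + c₄ + c₃ * m1 / m0)) = m0 * Δ / 2 + J + m0 * c₄ + c₃ * m1 := by
      field_simp
      ring
    rw [this]
    linarith
  exact le_of_mul_le_mul_left h5 hm

variable {w : E → ℝ} {b : ℝ}

lemma shifted_weight_integral_bounds {μ : Measure E} [IsProbabilityMeasure μ]
    (hwm : Measurable w) (hw1 : ∀ x, 1 ≤ w x) (hwb : ∀ x y, w x ≤ Real.exp (b * ‖y‖) * w (x + y))
    (hwi : Integrable w μ) {C : Set E} (hC : MeasurableSet C) (y : E) :
    Real.exp (-(b * ‖y‖)) * μ.real {x | x + y ∈ C} ≤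
        ∫ x, C.indicator (fun z => (w z)⁻¹) (x + y) * w x ∂μ ∧
      ∫ x, C.indicator (fun z => (w z)⁻¹) (x + y) * w x ∂μ ≤
        Real.exp (b * ‖y‖) * μ.real {x | x + y ∈ C} ∧
      0 ≤ ∫ x, C.indicator (fun z => (w z)⁻¹) (x + y) * w x ∂μ ∧
      ∫ x, C.indicator (fun z => (w z)⁻¹) (x + y) * w x ∂μ ≤ ∫ x, w x ∂μ := by
  have hw0 : ∀ x, 0 < w x := fun x => zero_lt_one.trans_le (hw1 x)
  have hS : MeasurableSet {x | x + y ∈ C} := measurable_add_const y hC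
  have hg0 : ∀ x, 0 ≤ C.indicator (fun z => (w z)⁻¹) x := fun x =>
    Set.indicator_nonneg (fun z _ => (inv_pos.2 (hw0 z)).le) x
  have hg1 : ∀ x, C.indicator (fun z => (w z)⁻¹) x ≤ 1 := fun x =>
    Set.indicator_le' (fun z _ => inv_le_one_of_one_le₀ (hw1 z)) (fun _ _ => zero_le_one) x
  have hgm : Measurable (C.indicator (fun z => (w z)⁻¹)) := hwm.inv.indicator hC
  have hint : Integrable (fun x => C.indicator (fun z => (w z)⁻¹) (x + y) * w x) μ := by
    refine hwi.bdd_mul (c := 1) (hgm.comp (measurable_add_const y)).aestronglyMeasurable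
      (Eventually.of_forall fun x => ?_)
    rw [Real.norm_of_nonneg (hg0 _)]
    exact hg1 _
  have hconst : ∀ c : ℝ, Integrable ({x | x + y ∈ C}.indicator (fun _ => c)) μ := fun c =>
    (integrable_const c).indicator hS
  have hval : ∀ c : ℝ, ∫ x, {x | x + y ∈ C}.indicator (fun _ => c) x ∂μ =
      c * μ.real {x | x + y ∈ C} := fun c => by
    rw [integral_indicator_const c hS, smul_eq_mul, mul_comm]
  refine ⟨?_, ?_, integral_nonneg fun x => mul_nonneg (hg0 _) (hw0 x).le, ?_⟩
  · rw [← hval]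
    refine integral_mono (hconst _) hint fun x => ?_
    by_cases hx : x + y ∈ C
    · rw [Set.indicator_of_mem (by exact hx), Set.indicator_of_mem hx, Real.exp_neg,
        ← div_eq_inv_mul, le_div_iff₀ (hw0 _), inv_mul_le_iff₀ (Real.exp_pos _)]
      have := hwb (x + y) (-y)
      rwa [norm_neg, add_neg_cancel_right] at this
    · rw [Set.indicator_of_notMem (by exact hx)]
      exact mul_nonneg (hg0 _) (hw0 x).le
  · rw [← hval]
    refine integral_mono hint (hconst _) fun x => ?_
    by_cases hx : x + y ∈ C
    · rw [Set.indicator_of_mem (s := {x | x + y ∈ C}) (by exact hx), Set.indicator_of_mem hx,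
        inv_mul_le_iff₀ (hw0 _), mul_comm]
      exact hwb x y
    · rw [Set.indicator_of_notMem (s := {x | x + y ∈ C}) (by exact hx),
        Set.indicator_of_notMem hx, zero_mul]
  · exact integral_mono hint hwi fun x => mul_le_of_le_one_left (hw0 x).le (hg1 _)

end ShiftedWeight

section ConvexDistance

variable {d : ℕ}

lemma bddAbove_convexDist (μ ν : Measure (EuclideanSpace ℝ (Fin d))) [IsProbabilityMeasure μ]
    [IsProbabilityMeasure ν] :
    BddAbove (Set.range fun C : {C : Set (EuclideanSpace ℝ (Fin d)) //
      Convex ℝ C ∧ MeasurableSet C} => |μ.real C.1 - ν.real C.1|) := by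
  refine ⟨1, ?_⟩
  rintro _ ⟨C, rfl⟩
  have h1 := measureReal_nonneg (μ := μ) (s := C.1)
  have h2 := measureReal_nonneg (μ := ν) (s := C.1)
  have h3 := measureReal_le_one (μ := μ) (s := C.1)
  have h4 := measureReal_le_one (μ := ν) (s := C.1)
  exact abs_le.2 ⟨by linarith, by linarith⟩

lemma abs_sub_le_convexDist (μ ν : Measure (EuclideanSpace ℝ (Fin d))) [IsProbabilityMeasure μ]
    [IsProbabilityMeasure ν] {C : Set (EuclideanSpace ℝ (Fin d))} (hC : Convex ℝ C)
    (hCm : MeasurableSet C) : |μ.real C - ν.real C| ≤ convexDist μ ν :=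
  le_ciSup (bddAbove_convexDist μ ν) ⟨C, hC, hCm⟩

lemma exp_sub_one_le_mul_exp {x X : ℝ} (hx : 0 ≤ x) (hX : x ≤ X) :
    Real.exp x - 1 ≤ x * Real.exp X := by
  have h1 := Real.add_one_le_exp (-x)
  have h2 : Real.exp (-x) * Real.exp x = 1 := by rw [← Real.exp_add]; simp
  have h3 := Real.exp_le_exp.2 hX
  have h4 := Real.exp_pos x
  nlinarith

lemma exp_mul_le_add_mul_exp {p x y X : ℝ} (hp0 : 0 ≤ p) (hp1 : p ≤ 1) (hxy : x ≤ y)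
    (hy : 0 ≤ y) (hX : y ≤ X) : Real.exp x * p ≤ p + y * Real.exp X := by
  have h1 := exp_sub_one_le_mul_exp hy hX
  have h2 := Real.exp_le_exp.2 hxy
  have h3 : 0 ≤ y * Real.exp X := by positivity
  nlinarith

lemma sub_le_exp_neg_mul {p x y : ℝ} (hp0 : 0 ≤ p) (hp1 : p ≤ 1) (hxy : x ≤ y) (hy : 0 ≤ y) :
    p - y ≤ Real.exp (-x) * p := by
  have h1 := Real.add_one_le_exp (-y)
  have h2 : Real.exp (-y) ≤ Real.exp (-x) := Real.exp_le_exp.2 (by linarith)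
  nlinarith

set_option maxHeartbeats 1000000 in
/-- A smoothing inequality for the convex distance: if the boundary layers of convex sets have
small measure under `ν`, then the convex distance of `μ` and `ν` is controlled by the difference
of their weighted characteristic functions at low frequencies. -/
theorem exists_convexDist_le_of_weightedCharFun {ν : Measure (EuclideanSpace ℝ (Fin d))}
    [IsProbabilityMeasure ν] {c : ℝ} (hc : 0 ≤ c)
    (hero : ∀ C : Set (EuclideanSpace ℝ (Fin d)), Convex ℝ C → MeasurableSet C →
      ∀ s : ℝ, 0 < s → ∃ C' : Set (EuclideanSpace ℝ (Fin d)), Convex ℝ C' ∧ MeasurableSet C' ∧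
        (∀ x ∈ C', ∀ y : EuclideanSpace ℝ (Fin d), ‖y‖ ≤ s → x + y ∈ C) ∧
        ν.real C ≤ ν.real C' + c * s)
    (hdil : ∀ C : Set (EuclideanSpace ℝ (Fin d)), Convex ℝ C → MeasurableSet C →
      ∀ s : ℝ, 0 < s → ∃ C' : Set (EuclideanSpace ℝ (Fin d)), Convex ℝ C' ∧ MeasurableSet C' ∧
        (∀ x ∈ C, ∀ y : EuclideanSpace ℝ (Fin d), ‖y‖ ≤ s → x + y ∈ C') ∧
        ν.real C' ≤ ν.real C + c * s)
    {w : EuclideanSpace ℝ (Fin d) → ℝ} {b : ℝ} (hb : 0 ≤ b)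
    (hwm : Measurable w) (hw1 : ∀ x, 1 ≤ w x) (hwb : ∀ x y, w x ≤ Real.exp (b * ‖y‖) * w (x + y))
    (hwinv : Integrable (fun x => (w x)⁻¹)) (hν : Integrable w ν) {Mw : ℝ}
    (hνM : ∫ x, w x ∂ν ≤ Mw) {h : EuclideanSpace ℝ (Fin d) → ℝ} (hh : Integrable h)
    (hh0 : ∀ η, 0 ≤ h η) {ρ : ℝ} (hρ : 0 < ρ) :
    ∃ A : ℝ, 0 ≤ A ∧ ∀ (μ : Measure (EuclideanSpace ℝ (Fin d))) [IsProbabilityMeasure μ]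
      (ε a : ℝ), 0 < ε → ε ≤ 1 → 0 ≤ a → Integrable w μ → ∫ x, w x ∂μ ≤ Mw →
      (∀ η, ε * ‖η‖ ≤ ρ → ‖weightedCharFun w μ η - weightedCharFun w ν η‖ ≤ a * h η) →
      convexDist μ ν ≤ A * (a + ε) := by
  obtain ⟨k, χ, hkc, hk0, hki, hk1, hm, hχc, hχi, ⟨M, hχM⟩, hχρ, hkχ⟩ :=
    exists_bandlimited_kernel (E := EuclideanSpace ℝ (Fin d)) hρ
  set m0 := ∫ v, k v with hm0
  set m1 := ∫ v, ‖v‖ * k v with hm1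
  have hm10 : 0 ≤ m1 := integral_nonneg fun v => mul_nonneg (norm_nonneg _) (hk0 v)
  set R : ℝ := 4 * m1 / m0 + 1 with hRdef
  have hR : 0 < R := by positivity
  have hmR : m1 / R ≤ m0 / 4 := by
    rw [div_le_iff₀ hR, hRdef]
    have : m0 / 4 * (4 * m1 / m0 + 1) = m1 + m0 / 4 := by field_simp
    rw [this]; linarith
  have hM0 : 0 ≤ M := (norm_nonneg _).trans (hχM 0)
  have hMw : 0 ≤ Mw := (integral_nonneg fun x => zero_le_one.trans (hw1 x)).trans hνM
  set c3 : ℝ := 2 * b * Real.exp b + Mw with hc3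
  have hc30 : 0 ≤ c3 := by positivity
  set c4 : ℝ := R * (b * Real.exp (b * R) + b + 2 * c) with hc4
  have hc40 : 0 ≤ c4 := by positivity
  set J0 : ℝ := M * (∫ η, h η) * ∫ u, (w u)⁻¹ with hJ0
  have hh00 : 0 ≤ ∫ η, h η := integral_nonneg hh0
  have hw0 : ∀ x, 0 < w x := fun x => zero_lt_one.trans_le (hw1 x)
  have hwi0 : 0 ≤ ∫ u, (w u)⁻¹ := integral_nonneg fun x => (inv_pos.2 (hw0 x)).le
  have hJ00 : 0 ≤ J0 := by positivity
  set A0 : ℝ := J0 / m0 + c4 + c3 * m1 / m0 with hA0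
  have hA00 : 0 ≤ A0 := by positivity
  refine ⟨2 * A0, by positivity, ?_⟩
  intro μ _ ε a hε hε1 ha hμ hμM hdiff
  set Δ := convexDist μ ν with hΔ
  have hΔC : ∀ C, Convex ℝ C → MeasurableSet C → |μ.real C - ν.real C| ≤ Δ := fun C hC hCm =>
    abs_sub_le_convexDist μ ν hC hCm
  have hΔ0 : 0 ≤ Δ := (abs_nonneg _).trans (hΔC ∅ convex_empty MeasurableSet.empty)
  set g : Set (EuclideanSpace ℝ (Fin d)) → EuclideanSpace ℝ (Fin d) → ℝ :=
    fun C => C.indicator (fun z => (w z)⁻¹) with hg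
  set F : Set (EuclideanSpace ℝ (Fin d)) → EuclideanSpace ℝ (Fin d) → ℝ := fun C y =>
    (∫ x, g C (x + ε • y) * w x ∂μ) - ∫ x, g C (x + ε • y) * w x ∂ν with hF
  have hFint : ∀ C, MeasurableSet C → Integrable (fun y => k y * F C y) ∧
      |∫ y, k y * F C y| ≤ J0 * a := by
    intro C hCm
    have hg0 : ∀ x, 0 ≤ g C x := fun x =>
      Set.indicator_nonneg (fun z _ => (inv_pos.2 (hw0 z)).le) x
    have hg1 : ∀ x, g C x ≤ 1 := fun x =>
      Set.indicator_le' (fun z _ => inv_le_one_of_one_le₀ (hw1 z)) (fun _ _ => zero_le_one) x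
    have key := abs_integral_kernel_mul_shift_sub_le hμ hν (fun x => (hw0 x).le) hki hkc hχi hkχ
      hχM hχρ hh hh0 ha hε hdiff (hwm.inv.indicator hCm) hg0 hg1 (hwinv.indicator hCm)
    refine ⟨key.1, key.2.trans ?_⟩
    have h1 : ∫ u, g C u ≤ ∫ u, (w u)⁻¹ :=
      integral_mono (hwinv.indicator hCm) hwinv fun u =>
        Set.indicator_le_self' (fun z _ => (inv_pos.2 (hw0 z)).le) u
    calc M * a * (∫ η, h η) * ∫ u, g C u ≤ M * a * (∫ η, h η) * ∫ u, (w u)⁻¹ := by gcongr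
      _ = J0 * a := by rw [hJ0]; ring
  have hnorm : ∀ y : EuclideanSpace ℝ (Fin d), ‖ε • y‖ = ε * ‖y‖ := fun y => by
    rw [norm_smul, Real.norm_of_nonneg hε.le]
  have hFbound : ∀ C, Convex ℝ C → MeasurableSet C → ∀ y, |F C y| ≤ Δ + c3 * ε * ‖y‖ := by
    intro C hC hCm y
    obtain ⟨hμ1, hμ2, hμ3, hμ4⟩ := shifted_weight_integral_bounds hwm hw1 hwb hμ hCm (ε • y)
    obtain ⟨hν1, hν2, hν3, hν4⟩ := shifted_weight_integral_bounds hwm hw1 hwb hν hCm (ε • y)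
    rw [hnorm] at hμ1 hμ2 hν1 hν2
    set t := ε * ‖y‖ with ht
    have ht0 : 0 ≤ t := by positivity
    have hct : c3 * ε * ‖y‖ = c3 * t := by rw [ht]; ring
    rw [hct]
    set S := {x | x + ε • y ∈ C} with hS
    have hSc : Convex ℝ S := hC.translate_preimage_left (ε • y)
    have hSm : MeasurableSet S := measurable_add_const _ hCm
    have hSΔ := abs_le.1 (hΔC S hSc hSm)
    rcases le_or_gt t 1 with ht1 | ht1
    · have hμS := measureReal_le_one (μ := μ) (s := S)
      have hνS := measureReal_le_one (μ := ν) (s := S)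
      have hμS0 := measureReal_nonneg (μ := μ) (s := S)
      have hνS0 := measureReal_nonneg (μ := ν) (s := S)
      have hbt : 0 ≤ b * t := by positivity
      have htb : b * t ≤ b := mul_le_of_le_one_right hb ht1
      have he5 : b * t ≤ b * t * Real.exp b := le_mul_of_one_le_right hbt (Real.one_le_exp hb)
      have hq : c3 * t = b * t * Real.exp b + b * t * Real.exp b + Mw * t := by rw [hc3]; ring
      have hMt : 0 ≤ Mw * t := by positivity
      have a1 := exp_mul_le_add_mul_exp hμS0 hμS le_rfl hbt htb
      have a2 := exp_mul_le_add_mul_exp hνS0 hνS le_rfl hbt htb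
      have a3 := sub_le_exp_neg_mul hμS0 hμS le_rfl hbt
      have a4 := sub_le_exp_neg_mul hνS0 hνS le_rfl hbt
      exact abs_le.2 ⟨by simp only [hF, hg]; linarith, by simp only [hF, hg]; linarith⟩
    · have h1 : Mw ≤ c3 * t := by
        have : Mw * 1 ≤ c3 * t := by
          refine mul_le_mul ?_ ht1.le zero_le_one hc30
          rw [hc3]
          have : 0 ≤ 2 * b * Real.exp b := by positivity
          linarith
        linarith
      exact abs_le.2 ⟨by simp only [hF, hg]; linarith, by simp only [hF, hg]; linarith⟩
  set s := ε * R with hs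
  have hs0 : 0 < s := by positivity
  have hbs : 0 ≤ b * s := by positivity
  have hsR : b * s ≤ b * R := by
    refine mul_le_mul_of_nonneg_left ?_ hb
    rw [hs]; exact mul_le_of_le_one_left hR.le hε1
  have hc4s : c4 * ε = b * s * Real.exp (b * R) + b * s + 2 * (c * s) := by rw [hc4, hs]; ring
  have hup : ∀ (p t : ℝ), 0 ≤ p → p ≤ 1 → t ≤ s →
      Real.exp (b * t) * p ≤ p + b * s * Real.exp (b * R) := fun p t hp0 hp1 hts =>
    exp_mul_le_add_mul_exp hp0 hp1 (mul_le_mul_of_nonneg_left hts hb) hbs hsR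
  have hlo : ∀ (p t : ℝ), 0 ≤ p → p ≤ 1 → t ≤ s → p - b * s ≤ Real.exp (-(b * t)) * p :=
    fun p t hp0 hp1 hts => sub_le_exp_neg_mul hp0 hp1 (mul_le_mul_of_nonneg_left hts hb) hbs
  have hyR : ∀ y : EuclideanSpace ℝ (Fin d), ‖y‖ ≤ R → ‖ε • y‖ ≤ s := fun y hy => by
    rw [hnorm, hs]; gcongr
  have hconcl : ∀ T : ℝ, T ≤ Δ / 2 + (J0 * a / m0 + c4 * ε + c3 * ε * m1 / m0) →
      T ≤ Δ / 2 + A0 * (a + ε) := by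
    intro T hT
    refine hT.trans ?_
    have h1 : A0 * (a + ε) = (J0 * a / m0 + c4 * ε + c3 * ε * m1 / m0) +
        (J0 / m0 * ε + c4 * a + c3 * m1 / m0 * a) := by rw [hA0]; ring
    have h2 : 0 ≤ J0 / m0 * ε + c4 * a + c3 * m1 / m0 * a := by positivity
    linarith
  have hone : ∀ (τ : Measure (EuclideanSpace ℝ (Fin d))) [IsProbabilityMeasure τ] (S : Set _),
      0 ≤ τ.real S ∧ τ.real S ≤ 1 := fun τ _ S => ⟨measureReal_nonneg, measureReal_le_one⟩
  have hmain : ∀ C, Convex ℝ C → MeasurableSet C →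
      |μ.real C - ν.real C| ≤ Δ / 2 + A0 * (a + ε) := by
    intro C hC hCm
    have hCΔ := abs_le.1 (hΔC C hC hCm)
    refine abs_le.2 ⟨?_, ?_⟩
    · obtain ⟨C1, hC1, hC1m, hsub1, hle1⟩ := hero C hC hCm s hs0
      obtain ⟨C2, hC2, hC2m, hsub2, hle2⟩ := hero C1 hC1 hC1m s hs0
      have hFi := hFint C1 hC1m
      have key := le_of_forall_kernel_average (G := fun y => -F C1 y) hk0 hki hk1 hm hR hmR
        (Δ := Δ) (T := ν.real C - μ.real C) (c₃ := c3 * ε) (c₄ := c4 * ε) (J := J0 * a)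
        (by linarith) (by linarith) (by positivity) (by positivity)
        (fun y => by have := (abs_le.1 (hFbound C1 hC1 hC1m y)).2; linarith)
        (fun y hy => ?_) (by simp only [mul_neg]; exact hFi.1.neg)
        (by simp only [mul_neg, integral_neg]; have := (abs_le.1 hFi.2).1; linarith)
      · have := hconcl _ key
        linarith
      · obtain ⟨-, hμ2, -, -⟩ := shifted_weight_integral_bounds hwm hw1 hwb hμ hC1m (ε • y)
        obtain ⟨hν1, -, -, -⟩ := shifted_weight_integral_bounds hwm hw1 hwb hν hC1m (ε • y)
        have e1 : μ.real {x | x + ε • y ∈ C1} ≤ μ.real C := measureReal_mono fun x hx => by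
          have := hsub1 _ hx (-(ε • y)) (by rw [norm_neg]; exact hyR y hy)
          rwa [add_neg_cancel_right] at this
        have e2 : ν.real C2 ≤ ν.real {x | x + ε • y ∈ C1} := measureReal_mono fun x hx =>
          hsub2 _ hx _ (hyR y hy)
        have e3 := hup _ _ (hone μ {x | x + ε • y ∈ C1}).1 (hone μ {x | x + ε • y ∈ C1}).2
          (hyR y hy)
        have e4 := hlo _ _ (hone ν {x | x + ε • y ∈ C1}).1 (hone ν {x | x + ε • y ∈ C1}).2
          (hyR y hy)
        simp only [hF, hg]
        linarith
    · obtain ⟨C1, hC1, hC1m, hsub1, hle1⟩ := hdil C hC hCm s hs0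
      obtain ⟨C2, hC2, hC2m, hsub2, hle2⟩ := hdil C1 hC1 hC1m s hs0
      have hFi := hFint C1 hC1m
      have key := le_of_forall_kernel_average (G := fun y => F C1 y) hk0 hki hk1 hm hR hmR
        (Δ := Δ) (T := μ.real C - ν.real C) (c₃ := c3 * ε) (c₄ := c4 * ε) (J := J0 * a)
        (by linarith) (by linarith) (by positivity) (by positivity)
        (fun y => by have := (abs_le.1 (hFbound C1 hC1 hC1m y)).1; linarith)
        (fun y hy => ?_) hFi.1 (abs_le.1 hFi.2).2
      · exact hconcl _ key
      · obtain ⟨hμ1, -, -, -⟩ := shifted_weight_integral_bounds hwm hw1 hwb hμ hC1m (ε • y)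
        obtain ⟨-, hν2, -, -⟩ := shifted_weight_integral_bounds hwm hw1 hwb hν hC1m (ε • y)
        have e1 : ν.real {x | x + ε • y ∈ C1} ≤ ν.real C2 := measureReal_mono fun x hx => by
          have := hsub2 _ hx (-(ε • y)) (by rw [norm_neg]; exact hyR y hy)
          rwa [add_neg_cancel_right] at this
        have e2 : μ.real C ≤ μ.real {x | x + ε • y ∈ C1} := measureReal_mono fun x hx =>
          hsub1 _ hx _ (hyR y hy)
        have e3 := hup _ _ (hone ν {x | x + ε • y ∈ C1}).1 (hone ν {x | x + ε • y ∈ C1}).2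
          (hyR y hy)
        have e4 := hlo _ _ (hone μ {x | x + ε • y ∈ C1}).1 (hone μ {x | x + ε • y ∈ C1}).2
          (hyR y hy)
        simp only [hF, hg]
        linarith
  have : Nonempty {C : Set (EuclideanSpace ℝ (Fin d)) // Convex ℝ C ∧ MeasurableSet C} :=
    ⟨⟨∅, convex_empty, MeasurableSet.empty⟩⟩
  have hsup : Δ ≤ Δ / 2 + A0 * (a + ε) := ciSup_le fun C => hmain C.1 C.2.1 C.2.2
  linarith

end ConvexDistance

section ExpWeight

variable {d : ℕ}

lemma norm_le_sum_abs (x : EuclideanSpace ℝ (Fin d)) : ‖x‖ ≤ ∑ j, |x j| := by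
  have h0 : 0 ≤ ∑ j, |x j| := Finset.sum_nonneg fun j _ => abs_nonneg _
  rw [← sq_le_sq₀ (norm_nonneg _) h0, EuclideanSpace.real_norm_sq_eq]
  calc ∑ j, x j ^ 2 = ∑ j, |x j| ^ 2 := by simp only [sq_abs]
    _ ≤ _ := Finset.sum_sq_le_sq_sum_of_nonneg fun j _ => abs_nonneg _

lemma one_le_expWeight (x : Fin d → ℝ) : 1 ≤ expWeight x :=
  (Real.one_le_exp (Finset.sum_nonneg fun _ _ => abs_nonneg _)).trans
    (exp_sum_abs_le_expWeight x)

lemma expWeight_le_exp_mul (x y : EuclideanSpace ℝ (Fin d)) :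
    expWeight (fun j => x j) ≤ Real.exp (d * ‖y‖) * expWeight (fun j => (x + y) j) := by
  unfold expWeight
  rw [Finset.mul_sum]
  refine Finset.sum_le_sum fun σ _ => ?_
  rw [← Real.exp_add]
  refine Real.exp_le_exp.2 ?_
  have h1 : ∀ j ∈ Finset.univ, -(signVec σ j * y j) ≤ ‖y‖ := fun j _ => by
    refine (neg_le_abs _).trans ?_
    rw [abs_mul, abs_signVec, one_mul]
    exact PiLp.norm_apply_le y j
  have h2 := Finset.sum_le_card_nsmul _ _ _ h1
  rw [Finset.card_univ, Fintype.card_fin, nsmul_eq_mul, Finset.sum_neg_distrib] at h2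
  simp only [PiLp.add_apply, mul_add, Finset.sum_add_distrib]
  linarith

lemma integrable_inv_one_add_norm_pow :
    Integrable (fun x : EuclideanSpace ℝ (Fin d) => ((1 + ‖x‖) ^ (d + 1))⁻¹) := by
  have h := integrable_one_add_norm (E := EuclideanSpace ℝ (Fin d)) (μ := volume)
    (r := ((d + 1 : ℕ) : ℝ)) (by simp)
  refine h.congr (Eventually.of_forall fun x => ?_)
  simp only []
  rw [Real.rpow_neg (by positivity), Real.rpow_natCast]

lemma continuous_expWeight :
    Continuous (fun x : EuclideanSpace ℝ (Fin d) => expWeight (fun j => x j)) := by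
  unfold expWeight; fun_prop

lemma integrable_inv_expWeight :
    Integrable (fun x : EuclideanSpace ℝ (Fin d) => (expWeight (fun j => x j))⁻¹) := by
  refine ((integrable_inv_one_add_norm_pow (d := d)).const_mul
    ((d + 1).factorial * Real.exp 1)).mono'
    (continuous_expWeight.measurable.inv.aestronglyMeasurable) (Eventually.of_forall fun x => ?_)
  have hw := zero_lt_one.trans_le (one_le_expWeight (fun j => x j))
  rw [Real.norm_of_nonneg (inv_pos.2 hw).le, inv_le_comm₀ hw (by positivity), mul_inv, inv_inv]
  have h1 := Real.pow_div_factorial_le_exp (x := 1 + ‖x‖) (by positivity) (d + 1)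
  rw [Real.exp_add] at h1
  have h2 : Real.exp ‖x‖ ≤ expWeight (fun j => x j) :=
    (Real.exp_le_exp.2 (norm_le_sum_abs x)).trans (exp_sum_abs_le_expWeight _)
  refine le_trans ?_ h2
  rw [mul_inv, mul_assoc, mul_left_comm, inv_mul_le_iff₀ (Real.exp_pos 1), ← div_eq_inv_mul]
  exact h1

variable {Ω : Type*} [MeasurableSpace Ω] {P : Measure Ω} {Y : Ω → EuclideanSpace ℝ (Fin d)}

lemma integrable_expWeight (h : ∀ σ : Fin d → Bool,
    Integrable (fun ω => Real.exp (∑ j, signVec σ j * Y ω j)) P) :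
    Integrable (fun ω => expWeight (fun j => Y ω j)) P :=
  integrable_finsetSum _ fun σ _ => h σ

lemma weightedCharFun_expWeight_map (hY : AEMeasurable Y P) (h : ∀ σ : Fin d → Bool,
    Integrable (fun ω => Real.exp (∑ j, signVec σ j * Y ω j)) P) (η : EuclideanSpace ℝ (Fin d)) :
    weightedCharFun (fun x : EuclideanSpace ℝ (Fin d) => expWeight (fun j => x j)) (P.map Y) η =
      ∑ σ : Fin d → Bool,
        ∫ ω, Complex.exp (∑ j, (signVec σ j + Complex.I * η j) * (Y ω j : ℂ)) ∂P := by
  unfold weightedCharFun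
  have hcont : Continuous fun x : EuclideanSpace ℝ (Fin d) => (expWeight (fun j => x j) : ℂ) *
      Complex.exp (Complex.I * (inner ℝ η x : ℝ)) := by
    have := continuous_expWeight (d := d)
    fun_prop
  rw [integral_map hY hcont.aestronglyMeasurable, ← integral_finsetSum]
  · refine integral_congr_ae (Eventually.of_forall fun ω => ?_)
    simp only [expWeight]
    push_cast
    rw [Finset.sum_mul]
    refine Finset.sum_congr rfl fun σ _ => ?_
    rw [← Complex.exp_add]
    congr 1
    rw [PiLp.inner_apply]
    push_cast
    rw [Finset.mul_sum, ← Finset.sum_add_distrib]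
    refine Finset.sum_congr rfl fun j _ => ?_
    simp only [RCLike.inner_apply, conj_trivial]
    push_cast
    ring
  · intro σ _
    refine (h σ).mono' ?_ (Eventually.of_forall fun ω => ?_)
    · have : Continuous fun x : EuclideanSpace ℝ (Fin d) =>
          Complex.exp (∑ j, (signVec σ j + Complex.I * η j) * (x j : ℂ)) := by fun_prop
      exact (this.measurable.comp_aemeasurable hY).aestronglyMeasurable
    · rw [Complex.norm_exp]
      refine le_of_eq ?_
      congr 1
      rw [Complex.re_sum]
      exact Finset.sum_congr rfl fun j _ => by simp

end ExpWeight

universe u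

/-- A Berry–Esseen bound for the convex distance to a nondegenerate Gaussian, for one random
vector with controlled joint cumulants. -/
theorem exists_convexDist_le_of_jointCumulant_bounds {d : ℕ} {K : Matrix (Fin d) (Fin d) ℝ}
    (hK : K.PosDef) {A : ℝ} (B : ℝ) (hA : 0 < A) :
    ∃ ρ C : ℝ, 0 < ρ ∧ ∀ {Ω : Type u} [MeasurableSpace Ω] (P : Measure Ω)
      [IsProbabilityMeasure P] (S : Ω → EuclideanSpace ℝ (Fin d)) (N D : ℝ), 0 < N → 0 < D →
      AEMeasurable S P →
      (∀ᶠ z in 𝓝 (0 : Fin d → ℝ), Integrable (fun ω => Real.exp (∑ j, z j * S ω j)) P) →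
      (∀ j, ∫ ω, S ω j ∂P = 0) →
      (∀ i j, ∃ δ : ℝ, |δ| ≤ B * √(D / N) ∧
        jointCumulant P ![fun ω => S ω i, fun ω => S ω j] = N * D * K i j * (1 + δ)) →
      (∀ r : ℕ, 3 ≤ r → ∀ i : Fin r → Fin d, |jointCumulant P (fun k ω => S ω (i k))| ≤
        N * (2 * D) ^ (r - 1) * A ^ r * (r : ℝ) ^ (r - 2)) →
      √(D / N) ≤ ρ →
      convexDist (P.map (fun ω => (√(N * D))⁻¹ • S ω)) (multivariateGaussian 0 K)
        ≤ C * √(D / N) := by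
  obtain ⟨ρ, C, hρ, hC, hdiff⟩ := exists_laplace_diff_bound.{u} hK B hA
  obtain ⟨c1, hc1, hero⟩ := multivariateGaussian_exists_erosion hK
  obtain ⟨c2, hc2, hdil⟩ := multivariateGaussian_exists_dilation hK
  set ν := multivariateGaussian (0 : EuclideanSpace ℝ (Fin d)) K with hν
  set w : EuclideanSpace ℝ (Fin d) → ℝ := fun x => expWeight (fun j => x j) with hw
  have hνexp : ∀ σ : Fin d → Bool, Integrable (fun x : EuclideanSpace ℝ (Fin d) =>
      Real.exp (∑ j, signVec σ j * x j)) ν := fun σ =>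
    (multivariateGaussian_exp hK.posSemidef (signVec σ)).1
  have hνw : Integrable w ν := integrable_expWeight (Y := fun x => x) hνexp
  set q : ℝ := (Fintype.card (Fin d → Bool) : ℝ) with hq
  obtain ⟨A', hA', hmain⟩ := exists_convexDist_le_of_weightedCharFun (ν := ν) (c := c1 + c2)
    (by positivity)
    (fun C hC hCm s hs => by
      obtain ⟨C', h1, h2, h3, h4⟩ := hero C hC hCm s hs.le
      exact ⟨C', h1, h2, h3, h4.trans (by gcongr; linarith)⟩)
    (fun C hC hCm s hs => by
      obtain ⟨C', h1, h2, h3, h4⟩ := hdil C hC hCm s hs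
      exact ⟨C', h1, h2, h3, h4.trans (by gcongr; linarith)⟩)
    (w := w) (b := d) (by positivity) continuous_expWeight.measurable
    (fun x => one_le_expWeight _) expWeight_le_exp_mul integrable_inv_expWeight hνw
    (Mw := ∫ x, w x ∂ν + q * C) (by linarith [show 0 ≤ q * C by positivity])
    integrable_inv_one_add_norm_pow (fun η => by positivity) hρ
  refine ⟨min ρ 1, A' * (q * C + 1), lt_min hρ one_pos, ?_⟩
  intro Ω _ P _ S N D hN hD hS hint hmean hcov hhigh hε
  set ε := √(D / N) with hεdef
  have hε0 : 0 < ε := Real.sqrt_pos.2 (by positivity)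
  have hε1 : ε ≤ 1 := hε.trans (min_le_right _ _)
  have hSj : ∀ j, AEMeasurable (fun ω => S ω j) P := fun j =>
    (EuclideanSpace.proj (𝕜 := ℝ) j).continuous.measurable.comp_aemeasurable hS
  have hlap := hdiff P (fun j ω => S ω j) N D hN hD hSj hint hmean hcov hhigh
    (hε.trans (min_le_left _ _))
  set Y : Ω → EuclideanSpace ℝ (Fin d) := fun ω => (√(N * D))⁻¹ • S ω with hYdef
  have hY : AEMeasurable Y P := hS.fun_const_smul _
  have hYexp : ∀ σ : Fin d → Bool,
      Integrable (fun ω => Real.exp (∑ j, signVec σ j * Y ω j)) P := fun σ => (hlap σ).1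
  have hμprob : IsProbabilityMeasure (P.map Y) := Measure.isProbabilityMeasure_map hY
  have hμw : Integrable w (P.map Y) :=
    (integrable_map_measure continuous_expWeight.aestronglyMeasurable hY).2
      (integrable_expWeight hYexp)
  have hΦ : ∀ η : EuclideanSpace ℝ (Fin d), ε * ‖η‖ ≤ ρ →
      ‖weightedCharFun w (P.map Y) η - weightedCharFun w ν η‖ ≤
        (q * C * ε) * ((1 + ‖η‖) ^ (d + 1))⁻¹ := by
    intro η hη
    have h1 := weightedCharFun_expWeight_map hY hYexp η
    have h2 := weightedCharFun_expWeight_map (P := ν) (Y := fun x => x) aemeasurable_id' hνexp η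
    rw [Measure.map_id'] at h2
    rw [h1, h2, ← Finset.sum_sub_distrib]
    have h3 := norm_sum_le_of_le Finset.univ fun σ _ => (hlap σ).2 η hη
    refine h3.trans (le_of_eq ?_)
    rw [Finset.sum_const, Finset.card_univ, nsmul_eq_mul, ← hq]
    ring
  have hμM : ∫ x, w x ∂(P.map Y) ≤ ∫ x, w x ∂ν + q * C := by
    have h1 := hΦ 0 (by simpa using hρ.le)
    have h2 : ∀ τ : Measure (EuclideanSpace ℝ (Fin d)),
        weightedCharFun w τ 0 = ((∫ x, w x ∂τ : ℝ) : ℂ) := by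
      intro τ
      rw [← integral_complex_ofReal]
      simp [weightedCharFun]
    rw [h2, h2, ← Complex.ofReal_sub, Complex.norm_real, Real.norm_eq_abs] at h1
    have h3 : q * C * ε ≤ q * C := mul_le_of_le_one_right (by positivity) hε1
    have h4 := (abs_le.1 h1).2
    simp only [norm_zero, add_zero, one_pow, inv_one, mul_one] at h4
    linarith
  refine (hmain (P.map Y) ε (q * C * ε) hε0 hε1 (by positivity) hμw hμM hΦ).trans_eq ?_
  ring

lemma integral_apply_eq_zero {d : ℕ} {Ω : Type*} [MeasurableSpace Ω] {P : Measure Ω}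
    {S : Ω → EuclideanSpace ℝ (Fin d)} (hS : AEMeasurable S P)
    (hint : ∀ᶠ z in 𝓝 (0 : Fin d → ℝ), Integrable (fun ω => Real.exp (∑ j, z j * S ω j)) P)
    (h0 : ∫ ω, S ω ∂P = 0) (j : Fin d) : ∫ ω, S ω j ∂P = 0 := by
  have hSi : ∀ i, Integrable (fun ω => S ω i) P := by
    intro i
    have h1 := zero_mem_interior_integrableExpSet_linear_combination
      (X := fun j ω => S ω j) hint (Pi.single i 1)
    have h2 := integrable_pow_of_mem_interior_integrableExpSet h1 1
    simpa [Pi.single_apply] using h2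
  have hSint : Integrable S P := by
    refine (integrable_finsetSum Finset.univ fun i _ => (hSi i).abs).mono'
      hS.aestronglyMeasurable (Eventually.of_forall fun ω => norm_le_sum_abs _)
  have := (EuclideanSpace.proj (𝕜 := ℝ) j : EuclideanSpace ℝ (Fin d) →L[ℝ] ℝ).integral_comp_comm
    hSint
  rw [h0, map_zero] at this
  exact this

theorem mainTheorem4 (d : ℕ) (K : Matrix (Fin d) (Fin d) ℝ) (hK : K.PosDef)
    (A B : ℝ) (hA : 0 < A) :
    ∃ C : ℝ,
      ∀ (Ω : ℕ → Type*) [∀ n, MeasurableSpace (Ω n)] (P : ∀ n, Measure (Ω n))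
        [∀ n, IsProbabilityMeasure (P n)]
        (S : ∀ n, Ω n → EuclideanSpace ℝ (Fin d)) (N D : ℕ → ℝ),
        (∀ n, AEMeasurable (S n) (P n)) →
        -- each Laplace transform is finite near the origin, so that all cumulants exist
        (∀ n, ∀ᶠ z in 𝓝 (0 : EuclideanSpace ℝ (Fin d)),
          Integrable (fun ω => Real.exp (∑ i, z i * S n ω i)) (P n)) →
        (∀ n, 0 < N n) → (∀ n, 0 < D n) →
        Tendsto (fun n => D n / N n) atTop (𝓝 0) →
        -- the vectors are centred
        (∀ n, ∫ ω, S n ω ∂(P n) = 0) →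
        -- `κ(S^i, S^j) = N D K_ij (1 + O(√(D/N)))`, with constant `B` in the `O`
        (∀ᶠ n in atTop, ∀ i j : Fin d, ∃ δ : ℝ, |δ| ≤ B * √(D n / N n) ∧
          jointCumulant (P n) ![fun ω => S n ω i, fun ω => S n ω j]
            = N n * D n * K i j * (1 + δ)) →
        -- bound on the cumulants of order at least `3`
        (∀ n, ∀ r : ℕ, 3 ≤ r → ∀ i : Fin r → Fin d,
          |jointCumulant (P n) (fun k ω => S n ω (i k))|
            ≤ N n * (2 * D n) ^ (r - 1) * A ^ r * (r : ℝ) ^ (r - 2)) →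
        ∀ᶠ n in atTop,
          convexDist ((P n).map (fun ω => (√(N n * D n))⁻¹ • S n ω)) (multivariateGaussian 0 K)
            ≤ C * √(D n / N n) := by
  obtain ⟨ρ, C, hρ, hmain⟩ := exists_convexDist_le_of_jointCumulant_bounds hK B hA
  refine ⟨C, ?_⟩
  intro Ω _ P _ S N D hS hint hN hD hlim hmean hcov hhigh
  have hsqrt : Tendsto (fun n => √(D n / N n)) atTop (𝓝 0) := by
    simpa using hlim.sqrt
  filter_upwards [hcov, hsqrt.eventually_le_const hρ] with n hcovn hεn
  have hint' : ∀ᶠ z in 𝓝 (0 : Fin d → ℝ),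
      Integrable (fun ω => Real.exp (∑ j, z j * S n ω j)) (P n) := by
    have hc := (PiLp.continuous_toLp 2 (fun _ : Fin d => ℝ)).tendsto 0
    exact hc.eventually (hint n)
  exact hmain (P n) (S n) (N n) (D n) (hN n) (hD n) (hS n) hint'
    (integral_apply_eq_zero (hS n) hint' (hmean n)) hcovn (hhigh n) hεn
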